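/- Let $K$ be a field, let $n\ge m\ge 1$ be integers, let $S=K[x_1,\ldots,x_{n+m}]$, and let $$I=(x_1,\ldots,x_n)\cap(x_{n+1},\ldots,x_{n+m})\subset S.$$ A Stanley decomposition of $I$ is a finite decomposition $\mathcal D:\ I=\bigoplus_{i=1}^r m_iK[Z_i]$ as a $\mathbb Z^{n+m}$-graded $K$-vector space, where each $m_i\in I$ is homogeneous with respect to the $\mathbb Z^{n+m}$-grading, $Z_i\subset\{x_1,\ldots,x_{n+m}\}$, and $m_iK[Z_i]$ is a free $K[Z_i]$-module with basis $m_i$. Put $\operatorname{sdepth}(\mathcal D)=\min_i|Z_i|$, and let the Stanley depth $\operatorname{sdepth}(I)$ be the maximum of $\operatorname{sdepth}(\mathcal D)$ over all Stanley decompositions $\mathcal D$ of $I$. Let the Hilbert depth $\operatorname{hdepth}(I)$ be the maximal depth of a finitely generated ($\mathbb Z$-)graded $S$-module $N$ with the same Hilbert series as $I$ (each $x_i$ has degree $1$; the depth of $N$ is the maximal length of an $N$-regular sequence in $(x_1,\ldots,x_{n+m})$). Then: 1. If $n$ and $m$ are not both even, then $$\operatorname{sdepth}(I)=\operatorname{hdepth}(I)=\left\lceil\frac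 n2\right\rceil+\left\lceil\frac m2\right\rceil.$$ 2. If $n=2t$ and $m=2s$, then $$t+s\le\operatorname{sdepth}(I)\le\operatorname{hdepth}(I)=t+s+1.$$ In both cases, $\operatorname{hdepth}(I)=\left\lfloor\frac{n+m+2}{2}\right\rfloor$. -/

import Mathlib

open MvPolynomial

universe u v

namespace StanleyHilbert

section Modules

variable {K : Type u} [Field K]

/-- The `K`-subspace `m K[Z] = {u m : u ∈ K[Z]}` of a module `M` over `K[x_s : s ∈ σ]`, where
`K[Z]` is the subalgebra generated by the variables `x_s` with `s ∈ Z`. -/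
noncomputable def stanleySpace {σ : Type*} {M : Type v} [AddCommGroup M] [Module K M]
    [Module (MvPolynomial σ K) M] [IsScalarTower K (MvPolynomial σ K) M]
    (m : M) (Z : Finset σ) : Submodule K M :=
  (Subalgebra.toSubmodule (MvPolynomial.supported K (Z : Set σ))).map
    ((LinearMap.toSpanSingleton (MvPolynomial σ K) M m).restrictScalars K)

/-- A Stanley decomposition of a module `M` with multigrading `ℳ` (indexed by `ℤ^σ`):
finitely many homogeneous elements `m i` and sets of variables `Z i` such that
each `m i K[Z i]` is a free `K[Z i]`-module on `m i` and `M = ⨁ i, m i K[Z i]`.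
Since the `m i` are homogeneous, this is a decomposition into multigraded subspaces. -/
structure StanleyDecomposition {σ : Type*} {M : Type v} [AddCommGroup M] [Module K M]
    [Module (MvPolynomial σ K) M] [IsScalarTower K (MvPolynomial σ K) M]
    (ℳ : (σ → ℤ) → Submodule K M) where
  r : ℕ
  m : Fin r → M
  Z : Fin r → Finset σ
  homogeneous : ∀ i, ∃ a : σ → ℤ, m i ∈ ℳ a
  free : ∀ i, ∀ p ∈ MvPolynomial.supported K (Z i : Set σ), p • m i = 0 → p = 0
  isInternal : DirectSum.IsInternal fun i => stanleySpace (K := K) (m i) (Z i)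

/-- `sdepth 𝒟 = min_i |Z i|` for a Stanley decomposition `𝒟`. -/
noncomputable def StanleyDecomposition.sdepth {σ : Type*} {M : Type v} [AddCommGroup M]
    [Module K M] [Module (MvPolynomial σ K) M] [IsScalarTower K (MvPolynomial σ K) M]
    {ℳ : (σ → ℤ) → Submodule K M} (𝒟 : StanleyDecomposition ℳ) : ℕ∞ :=
  ⨅ i, ((𝒟.Z i).card : ℕ∞)

/-- The Stanley depth of a multigraded module: the maximal `sdepth 𝒟` over all its Stanley
decompositions `𝒟`. -/
noncomputable def stanleyDepth {σ : Type*} {M : Type v} [AddCommGroup M] [Module K M]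
    [Module (MvPolynomial σ K) M] [IsScalarTower K (MvPolynomial σ K) M]
    (ℳ : (σ → ℤ) → Submodule K M) : ℕ∞ :=
  ⨆ 𝒟 : StanleyDecomposition ℳ, 𝒟.sdepth

/-- `𝒩` makes `N` a `ℤ`-graded module over `K[x_s : s ∈ σ]`, every variable having degree `1`. -/
structure IsGradedModule {σ : Type*} {N : Type v} [AddCommGroup N] [Module K N]
    [Module (MvPolynomial σ K) N] (𝒩 : ℤ → Submodule K N) : Prop where
  isInternal : DirectSum.IsInternal 𝒩
  smul_mem : ∀ (i : ℕ) (j : ℤ) (p : MvPolynomial σ K) (x : N),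
    p.IsHomogeneous i → x ∈ 𝒩 j → p • x ∈ 𝒩 (i + j)

/-- The Hilbert series of a graded module, given by its coefficients `j ↦ dim_K N_j`. -/
noncomputable def hilbertSeries {N : Type v} [AddCommGroup N] [Module K N]
    (𝒩 : ℤ → Submodule K N) : ℤ → ℕ :=
  fun j => Module.finrank K (𝒩 j)

variable (K) in
/-- The depth of a (nonzero finitely generated graded) module `N` over `K[x_s : s ∈ σ]`: the
maximal length of an `N`-regular sequence in the ideal generated by the variables. -/
noncomputable def depth (σ : Type*) (N : Type v) [AddCommGroup N] [Module (MvPolynomial σ K) N] :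
    ℕ∞ :=
  ⨆ rs ∈ {rs : List (MvPolynomial σ K) |
      (∀ f ∈ rs, f ∈ Ideal.span (Set.range (X : σ → MvPolynomial σ K))) ∧
        RingTheory.Sequence.IsRegular N rs},
    (rs.length : ℕ∞)

/-- The Hilbert depth of a graded module `M` over `K[x_1, …, x_k]`: the maximal depth of a finitely
generated graded module `N` with the same Hilbert series as `M`. Every finitely generated module
is isomorphic to one in the universe of `K`. -/
noncomputable def hilbertDepth (k : ℕ) {M : Type v} [AddCommGroup M] [Module K M]
    (ℳ : ℤ → Submodule K M) : ℕ∞ :=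
  sSup {d : ℕ∞ | ∃ (N : Type u) (_ : AddCommGroup N) (_ : Module K N)
    (_ : Module (MvPolynomial (Fin k) K) N) (_ : IsScalarTower K (MvPolynomial (Fin k) K) N)
    (𝒩 : ℤ → Submodule K N),
      Module.Finite (MvPolynomial (Fin k) K) N ∧
      IsGradedModule (σ := Fin k) 𝒩 ∧
      hilbertSeries 𝒩 = hilbertSeries ℳ ∧
      d = depth K (Fin k) N}

end Modules

section Ideals

variable {K : Type u} [Field K]

/-- The part of multidegree `a` of an ideal: the multiples of the monomial `x^a` lying in `I`. -/
noncomputable def multidegreePart {σ : Type*} (I : Ideal (MvPolynomial σ K)) (a : σ → ℤ) :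
    Submodule K I :=
  (MvPolynomial.restrictSupport K {e : σ →₀ ℕ | ∀ s, (e s : ℤ) = a s}).comap
    (I.subtype.restrictScalars K)

/-- The part of degree `j` of an ideal: the homogeneous polynomials of degree `j` lying in `I`. -/
noncomputable def degreePart {σ : Type*} (I : Ideal (MvPolynomial σ K)) (j : ℤ) :
    Submodule K I :=
  (MvPolynomial.restrictSupport K {e : σ →₀ ℕ | (e.degree : ℤ) = j}).comap
    (I.subtype.restrictScalars K)

/-- The Stanley depth of a monomial ideal. -/
noncomputable def sdepth {σ : Type*} (I : Ideal (MvPolynomial σ K)) : ℕ∞ :=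
  stanleyDepth (multidegreePart I)

/-- The Hilbert depth of a homogeneous ideal of `K[x_1, …, x_k]`. -/
noncomputable def hdepth {k : ℕ} (I : Ideal (MvPolynomial (Fin k) K)) : ℕ∞ :=
  hilbertDepth k (degreePart I)

variable (K) in
/-- The ideal `(x_1, …, x_n) ∩ (x_{n+1}, …, x_{n+m})` of `K[x_1, …, x_{n+m}]`. -/
noncomputable def bipartiteIdeal (n m : ℕ) : Ideal (MvPolynomial (Fin (n + m)) K) :=
  Ideal.span (Set.range fun i : Fin n => X (Fin.castAdd m i)) ⊓
    Ideal.span (Set.range fun j : Fin m => X (Fin.natAdd n j))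

end Ideals

end StanleyHilbert

/-!
A Stanley decomposition splits the Hilbert series of `I` into terms `X ^ a / (1 - X) ^ d` with
`d ≥ sdepth 𝒟`. Conversely, any nonempty sum of such terms with `d ≥ q` is the Hilbert series of a
direct sum of shifted polynomial rings in `d` of the variables, on which `q` variables form a
regular sequence. Hence `sdepth I ≤ hdepth I`, and lower bounds for `hdepth I` only require
rewriting the Hilbert series `(1 / (1 - X) ^ n - 1) * (1 / (1 - X) ^ m - 1)`. For `m ≤ n`, the
identity `X / (1 - X) = 1 / (1 - X) - 1` telescopes it into the sum over `l < m` of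
`X / (1 - X) ^ (m - l) * (1 / (1 - X) ^ (n - m + 2 * l + 1) - 1)`, and a partition of the nonempty
subsets of `{1, …, k}` into intervals with upper ends of size at least `⌈k / 2⌉` expands
`1 / (1 - X) ^ k - 1`. Products of two such partitions bound `sdepth I` from below.

For the upper bound on `hdepth I`, a regular sequence of length `q` may be taken to consist of
linear forms after extending the field, and linear relations between its members have coefficients
of positive degree. It therefore embeds the `q`-th power of the lowest component, in degree `2`,
into the component of degree `3`. These have dimensions `n * m` and `n * m * (n + m + 2) / 2`, so
`q ≤ (n + m + 2) / 2`.
-/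

namespace StanleyHilbert

section BasisGradings

variable {K V ι κ : Type*} [Field K] [AddCommGroup V] [Module K V]

/-- The part of weight `k` of a space with basis `b` and weights `w i` on the basis vectors: the
span of the `b i` with `w i = k`. -/
noncomputable def basisPart (b : Module.Basis ι K V) (w : ι → κ) (k : κ) : Submodule K V :=
  (Finsupp.supported K K {i | w i = k}).map (b.repr.symm : (ι →₀ K) →ₗ[K] V)

lemma mem_basisPart_iff {b : Module.Basis ι K V} {w : ι → κ} {k : κ} {v : V} :
    v ∈ basisPart b w k ↔ ∀ i, w i ≠ k → b.repr v i = 0 := by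
  rw [basisPart, Submodule.mem_map_equiv, LinearEquiv.symm_symm, Finsupp.mem_supported']
  rfl

lemma basis_mem_basisPart (b : Module.Basis ι K V) (w : ι → κ) (i : ι) :
    b i ∈ basisPart b w (w i) :=
  mem_basisPart_iff.2 fun j hj => by
    rw [b.repr_self, Finsupp.single_eq_of_ne (by rintro rfl; exact hj rfl)]

lemma isInternal_basisPart [DecidableEq κ] (b : Module.Basis ι K V) (w : ι → κ) :
    DirectSum.IsInternal (basisPart b w) := by
  refine (DirectSum.isInternal_submodule_iff_iSupIndep_and_iSup_eq_top _).2 ⟨?_, ?_⟩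
  · have hdisj : iSupIndep fun k => Finsupp.supported K K {i | w i = k} := fun k =>
      (Finsupp.disjoint_supported_supported disjoint_compl_right).mono_right <|
        iSup₂_le fun l hl => Finsupp.supported_mono fun i hi hi' => hl (hi.symm.trans hi')
    exact (iSupIndep_map_orderIso_iff (Submodule.orderIsoMapComap b.repr.symm)).2 hdisj
  · rw [eq_top_iff, ← b.span_eq, Submodule.span_le]
    rintro _ ⟨i, rfl⟩
    exact Submodule.mem_iSup_of_mem (w i) (basis_mem_basisPart b w i)

lemma finrank_basisPart (b : Module.Basis ι K V) (w : ι → κ) (k : κ) :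
    Module.finrank K (basisPart b w k) = Nat.card {i // w i = k} :=
  Module.finrank_eq_nat_card_basis <| Module.Basis.ofRepr <|
    (b.repr.symm.submoduleMap _).symm ≪≫ₗ Finsupp.supportedEquivFinsupp {i | w i = k}

end BasisGradings

section DegreeSeries

open scoped PowerSeries

variable {ι κ : Type*}

/-- The generating function `∑ i, X ^ deg i` of a family of degrees. A degree that is attained
infinitely often contributes `0`. -/
noncomputable def degreeSeries (deg : ι → ℕ) : ℤ⟦X⟧ :=
  PowerSeries.mk fun j => (Nat.card {i // deg i = j} : ℤ)

lemma degreeSeries_congr {deg : ι → ℕ} {deg' : κ → ℕ} (e : ι ≃ κ)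
    (h : ∀ i, deg' (e i) = deg i) : degreeSeries deg = degreeSeries deg' := by
  ext j
  simp only [degreeSeries, PowerSeries.coeff_mk, Nat.cast_inj]
  exact Nat.card_congr (e.subtypeEquiv fun i => by rw [h])

lemma degreeSeries_prod {deg : ι → ℕ} {deg' : κ → ℕ} (h : ∀ j, Finite {i // deg i = j})
    (h' : ∀ j, Finite {i // deg' i = j}) :
    degreeSeries (fun p : ι × κ => deg p.1 + deg' p.2) =
      degreeSeries deg * degreeSeries deg' := by
  ext j
  let e : {p : ι × κ // deg p.1 + deg' p.2 = j} ≃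
      Σ q : Finset.HasAntidiagonal.antidiagonal j, {i // deg i = q.1.1} × {i // deg' i = q.1.2} :=
    { toFun := fun p => ⟨⟨(deg p.1.1, deg' p.1.2), Finset.HasAntidiagonal.mem_antidiagonal.2 p.2⟩,
        ⟨p.1.1, rfl⟩, ⟨p.1.2, rfl⟩⟩
      invFun := fun q => ⟨(q.2.1, q.2.2), by
        rw [q.2.1.2, q.2.2.2]; exact Finset.HasAntidiagonal.mem_antidiagonal.1 q.1.2⟩
      left_inv := fun _ => rfl
      right_inv := by
        rintro ⟨⟨⟨_, _⟩, _⟩, ⟨i, hi⟩, ⟨i', hi'⟩⟩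
        dsimp only at hi hi'
        subst hi hi'
        rfl }
  simp only [degreeSeries, PowerSeries.coeff_mk, PowerSeries.coeff_mul]
  rw [Nat.card_congr e, Nat.card_sigma, Finset.sum_coe_sort (Finset.HasAntidiagonal.antidiagonal j)
    fun q => Nat.card ({i // deg i = q.1} × {i // deg' i = q.2})]
  simp only [Nat.card_prod, Nat.cast_sum, Nat.cast_mul]

lemma degreeSeries_sigma {α : Type*} [Fintype α] {β : α → Type*} {deg : ∀ a, β a → ℕ}
    (h : ∀ a j, Finite {i // deg a i = j}) :
    degreeSeries (fun x : Σ a, β a => deg x.1 x.2) = ∑ a, degreeSeries (deg a) := by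
  ext j
  simp only [degreeSeries, PowerSeries.coeff_mk, map_sum]
  let e : {x : Σ a, β a // deg x.1 x.2 = j} ≃ Σ a, {i // deg a i = j} :=
    { toFun := fun x => ⟨x.1.1, x.1.2, x.2⟩
      invFun := fun x => ⟨⟨x.1, x.2.1⟩, x.2.2⟩
      left_inv := fun _ => rfl
      right_inv := fun _ => rfl }
  rw [Nat.card_congr e, Nat.card_sigma, Nat.cast_sum]

lemma degreeSeries_add_left (a : ℕ) (deg : ι → ℕ) :
    degreeSeries (fun i => a + deg i) = PowerSeries.X ^ a * degreeSeries deg := by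
  ext j
  rw [PowerSeries.coeff_X_pow_mul']
  split_ifs with h
  · simp only [degreeSeries, PowerSeries.coeff_mk, Nat.cast_inj]
    exact Nat.card_congr (Equiv.subtypeEquivRight fun i => by lia)
  · have : IsEmpty {i // a + deg i = j} := ⟨fun i => h (by have := i.2; lia)⟩
    simp [degreeSeries]

lemma finite_subtype_degree_eq {σ : Type*} [Finite σ] (P : (σ →₀ ℕ) → Prop) (j : ℕ) :
    Finite {e : {e // P e} // e.1.degree = j} := by
  have : Finite {e : σ →₀ ℕ // e.degree = j} := Finsupp.finite_of_degree_eq j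
  exact Finite.of_injective (fun e => (⟨e.1.1, e.2⟩ : {e : σ →₀ ℕ // e.degree = j}))
    fun _ _ h => by simpa only [Subtype.ext_iff] using h

lemma degreeSeries_degree (σ : Type*) [Fintype σ] :
    degreeSeries (Finsupp.degree : (σ →₀ ℕ) → ℕ) = PowerSeries.mk 1 ^ Fintype.card σ := by
  classical
  ext j
  have hcoeff := PowerSeries.coeff_prod (fun _ : σ => (PowerSeries.mk 1 : ℤ⟦X⟧)) j Finset.univ
  simp only [Finset.prod_const, Finset.card_univ, PowerSeries.coeff_mk, Pi.one_apply, one_pow,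
    Finset.sum_const, nsmul_one] at hcoeff
  rw [hcoeff, degreeSeries, PowerSeries.coeff_mk, Nat.cast_inj, ← Nat.card_eq_finsetCard]
  exact Nat.card_congr <| Equiv.subtypeEquivRight fun e => by
    simp [Finset.mem_finsuppAntidiag, Finsupp.degree_eq_sum]

lemma degreeSeries_degree_ne_zero (σ : Type*) [Fintype σ] :
    degreeSeries (fun e : {e : σ →₀ ℕ // e ≠ 0} => e.1.degree) =
      PowerSeries.mk 1 ^ Fintype.card σ - 1 := by
  rw [← degreeSeries_degree σ]
  ext j
  rw [map_sub, PowerSeries.coeff_one]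
  simp only [degreeSeries, PowerSeries.coeff_mk]
  split_ifs with hj
  · subst hj
    have : IsEmpty {e : {e : σ →₀ ℕ // e ≠ 0} // e.1.degree = 0} :=
      ⟨fun e => e.1.2 ((Finsupp.degree_eq_zero_iff _).1 e.2)⟩
    rw [Nat.card_of_isEmpty]
    simp only [Finsupp.degree_eq_zero_iff, Nat.card_unique, Nat.cast_zero, Nat.cast_one, sub_self]
  · rw [sub_zero, Nat.cast_inj]
    exact Nat.card_congr <| Equiv.subtypeSubtypeEquivSubtype
      (p := fun e : σ →₀ ℕ => e ≠ 0) (q := fun e => e.degree = j)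
      fun {e} he => by rintro rfl; exact hj (by simpa using he.symm)

variable {K V W : Type*} [Field K] [AddCommGroup V] [Module K V] [AddCommGroup W] [Module K W]

lemma coe_hilbertSeries_basisPart (b : Module.Basis ι K V) (deg : ι → ℕ) (j : ℕ) :
    (hilbertSeries (basisPart b fun i => (deg i : ℤ)) j : ℤ) =
      PowerSeries.coeff j (degreeSeries deg) := by
  simp only [hilbertSeries, finrank_basisPart, Nat.cast_inj, degreeSeries, PowerSeries.coeff_mk]

lemma hilbertSeries_basisPart_of_neg (b : Module.Basis ι K V) (deg : ι → ℕ) {j : ℤ} (hj : j < 0) :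
    hilbertSeries (basisPart b fun i => (deg i : ℤ)) j = 0 := by
  have : IsEmpty {i // (deg i : ℤ) = j} := ⟨fun i => by have := i.2; lia⟩
  rw [hilbertSeries, finrank_basisPart, Nat.card_of_isEmpty]

lemma hilbertSeries_basisPart_eq (b : Module.Basis ι K V) (b' : Module.Basis κ K W)
    {deg : ι → ℕ} {deg' : κ → ℕ} (h : degreeSeries deg = degreeSeries deg') :
    hilbertSeries (basisPart b fun i => (deg i : ℤ)) =
      hilbertSeries (basisPart b' fun i => (deg' i : ℤ)) := by
  funext j
  obtain ⟨j, rfl⟩ | hj := (le_or_gt 0 j).imp_left Int.eq_ofNat_of_zero_le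
  · rw [← Nat.cast_inj (R := ℤ), coe_hilbertSeries_basisPart, coe_hilbertSeries_basisPart, h]
  · rw [hilbertSeries_basisPart_of_neg b deg hj, hilbertSeries_basisPart_of_neg b' deg' hj]

end DegreeSeries

section IntervalPartitions

/-- The intervals `[A i, B i]` are nonempty and partition the set `S`. -/
structure IsIntervalPartition {α ι : Type*} [Preorder α] (S : Set α) (A B : ι → α) : Prop where
  le : ∀ i, A i ≤ B i
  Icc_subset : ∀ i, Set.Icc (A i) (B i) ⊆ S
  existsUnique : ∀ x ∈ S, ∃! i, x ∈ Set.Icc (A i) (B i)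

lemma IsIntervalPartition.prod {α β ι κ : Type*} [Preorder α] [Preorder β] {S : Set α} {T : Set β}
    {A B : ι → α} {A' B' : κ → β} (h : IsIntervalPartition S A B)
    (h' : IsIntervalPartition T A' B') :
    IsIntervalPartition (S ×ˢ T) (fun i : ι × κ => (A i.1, A' i.2))
      (fun i => (B i.1, B' i.2)) where
  le i := ⟨h.le i.1, h'.le i.2⟩
  Icc_subset i := by
    rw [← Set.Icc_prod_Icc]
    exact Set.prod_mono (h.Icc_subset i.1) (h'.Icc_subset i.2)
  existsUnique := by
    rintro ⟨x, y⟩ ⟨hx, hy⟩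
    obtain ⟨i, hi, hi'⟩ := h.existsUnique x hx
    obtain ⟨j, hj, hj'⟩ := h'.existsUnique y hy
    refine ⟨(i, j), ⟨⟨hi.1, hj.1⟩, ⟨hi.2, hj.2⟩⟩, ?_⟩
    rintro ⟨i₁, j₁⟩ ⟨hl, hr⟩
    exact Prod.ext (hi' i₁ ⟨hl.1, hr.1⟩) (hj' j₁ ⟨hl.2, hr.2⟩)

lemma IsIntervalPartition.preimage {α β ι : Type*} [Preorder α] [Preorder β] {S : Set β}
    {A B : ι → β} (h : IsIntervalPartition S A B) (φ : α ≃o β) :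
    IsIntervalPartition (φ ⁻¹' S) (φ.symm ∘ A) (φ.symm ∘ B) where
  le i := φ.symm.monotone (h.le i)
  Icc_subset i x hx := h.Icc_subset i ⟨φ.symm_apply_le.1 hx.1, φ.le_symm_apply.1 hx.2⟩
  existsUnique x hx := by
    simpa only [Set.mem_Icc, Function.comp_apply, φ.symm_apply_le, φ.le_symm_apply] using
      h.existsUnique (φ x) hx

variable {α : Type*} [LinearOrder α] {π : α → ZMod 2} {p : ZMod 2} {A C : Finset α} {a x : α}

/-- Reading `A` in increasing order, starting in state `p` and switching the state after each
element of `A`, the element `x` is compatible with `A` if its parity `π x` is the state at `x`. -/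
def ParityCompatible (π : α → ZMod 2) (p : ZMod 2) (A : Finset α) (x : α) : Prop :=
  π x = p + (A.filter (· < x)).card

lemma zmod_two_ne_iff {a b : ZMod 2} : a ≠ b ↔ a = b + 1 := by
  revert a b; decide

lemma parityCompatible_erase_iff (h : x ≤ a) :
    ParityCompatible π p (A.erase a) x ↔ ParityCompatible π p A x := by
  rw [ParityCompatible, Finset.filter_erase,
    Finset.erase_eq_of_notMem fun ha => (Finset.mem_filter.1 ha).2.not_ge h, ParityCompatible]

lemma parityCompatible_iff_of_forall_lt (h : ∀ y ∈ A, y < x) :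
    ParityCompatible π p A x ↔ π x = p + A.card := by
  rw [ParityCompatible, Finset.filter_true_of_mem h]

/-- `A ⊆ C` switches states exactly so that all elements of `C` have the parity of the state. -/
def IsParityCore (π : α → ZMod 2) (C : Finset α) (p : ZMod 2) (A : Finset α) : Prop :=
  A ⊆ C ∧ ∀ x ∈ C, ParityCompatible π p A x

lemma isParityCore_insert_iff (ha : ∀ x ∈ C, x < a) :
    IsParityCore π (insert a C) p A ↔
      IsParityCore π C p (A.erase a) ∧ π a = p + (A.erase a).card := by
  have hC : ∀ x ∈ C, (ParityCompatible π p (A.erase a) x ↔ ParityCompatible π p A x) :=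
    fun x hx => parityCompatible_erase_iff (ha x hx).le
  simp only [IsParityCore, Finset.forall_mem_insert, ← Finset.subset_insert_iff]
  rw [and_assoc, and_congr_right_iff]
  intro hA
  have hlt : ∀ y ∈ A.erase a, y < a := fun y hy => ha y (Finset.subset_insert_iff.1 hA hy)
  rw [← parityCompatible_iff_of_forall_lt hlt, parityCompatible_erase_iff le_rfl, and_comm,
    forall₂_congr hC]

lemma existsUnique_isParityCore (π : α → ZMod 2) (C : Finset α) (e : ZMod 2) :
    ∃! pA : ZMod 2 × Finset α, IsParityCore π C pA.1 pA.2 ∧ pA.1 + pA.2.card = e := by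
  induction C using Finset.induction_on_max generalizing e with
  | empty =>
    refine ⟨(e, ∅), by simp [IsParityCore], ?_⟩
    rintro ⟨p, A⟩ ⟨⟨hA, -⟩, h⟩
    obtain rfl := Finset.subset_empty.1 hA
    simpa using h
  | insert a C ha ih =>
    obtain ⟨⟨p, A⟩, ⟨hA, hp⟩, huniq⟩ := ih (π a)
    dsimp only at hA hp
    have haA : a ∉ A := fun h => (ha a (hA.1 h)).false
    simp only [isParityCore_insert_iff ha]
    have huniq' : ∀ (p' : ZMod 2) (A' : Finset α),
        IsParityCore π C p' (A'.erase a) ∧ π a = p' + (A'.erase a).card →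
          p' = p ∧ A'.erase a = A :=
      fun p' A' h => Prod.mk.inj (huniq (p', A'.erase a) ⟨h.1, h.2.symm⟩)
    by_cases he : e = π a
    · refine ⟨(p, A), ?_, ?_⟩
      · simpa only [Finset.erase_eq_of_notMem haA, he, hp, and_true] using hA
      · rintro ⟨p', A'⟩ ⟨h, he'⟩
        obtain ⟨rfl, rfl⟩ := huniq' p' A' h
        have : a ∉ A' := fun haA' => by
          rw [← Finset.card_erase_add_one haA', Nat.cast_succ, ← add_assoc, hp, he] at he'
          simp at he'
        rw [Finset.erase_eq_of_notMem this]
    · refine ⟨(p, insert a A), ?_, ?_⟩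
      · simp only [Finset.erase_insert haA, Finset.card_insert_of_notMem haA, Nat.cast_succ]
        exact ⟨⟨hA, hp.symm⟩, by rw [← add_assoc, hp, zmod_two_ne_iff.1 he]⟩
      · rintro ⟨p', A'⟩ ⟨h, he'⟩
        obtain ⟨rfl, rfl⟩ := huniq' p' A' h
        have : a ∈ A' := by
          by_contra haA'
          exact he (by rw [← he', ← hp, Finset.erase_eq_of_notMem haA'])
        rw [Finset.insert_erase this]

lemma IsParityCore.eq_min' (h : IsParityCore π C p A) (hC : C.Nonempty) : p = π (C.min' hC) := by
  have hmin := h.2 _ (C.min'_mem hC)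
  rw [ParityCompatible, Finset.filter_eq_empty_iff.2 fun x hx => (C.min'_le x (h.1 hx)).not_gt,
    Finset.card_empty, Nat.cast_zero, add_zero] at hmin
  exact hmin.symm

lemma existsUnique_isParityCore_card_odd (π : α → ZMod 2) (hC : C.Nonempty) :
    ∃! pA : ZMod 2 × Finset α, IsParityCore π C pA.1 pA.2 ∧ (pA.2.card : ZMod 2) = 1 := by
  refine (existsUnique_congr fun pA => and_congr_right fun h => ?_).1
    (existsUnique_isParityCore π C (π (C.min' hC) + 1))
  rw [← h.eq_min' hC, add_right_inj]

/-- The parity of the elements of `{0, …, n - 1}`. -/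
def finParity {n : ℕ} (x : Fin n) : ZMod 2 := (x : ℕ)

variable {k n : ℕ}

lemma parityCompatible_add_one_of_not {A : Finset (Fin (k + 1))} (hk : Even k)
    (hA : ∀ x ∈ A, ParityCompatible finParity p A x) (hodd : (A.card : ZMod 2) = 1)
    {x : Fin (k + 1)} (hx : ¬ ParityCompatible finParity p A x) :
    ParityCompatible finParity p A (x + 1) := by
  have hxA : x ∉ A := fun h => hx (hA x h)
  replace hx := zmod_two_ne_iff.1 hx
  obtain rfl | hlast := eq_or_ne x (Fin.last k)
  · have hlt : A.filter (· < Fin.last k) = A :=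
      Finset.filter_true_of_mem fun y hy => Fin.lt_last_iff_ne_last.2 (ne_of_mem_of_not_mem hy hxA)
    have hp : p = 0 := by
      simpa [finParity, hlt, hodd, (ZMod.natCast_eq_zero_iff_even).2 hk, add_assoc,
        CharTwo.add_self_eq_zero] using hx.symm
    simp [ParityCompatible, finParity, hp, Fin.last_add_one]
  · have hval : ((x + 1 : Fin (k + 1)) : ℕ) = x + 1 :=
      Fin.val_add_one_of_lt (Fin.lt_last_iff_ne_last.2 hlast)
    have hfilter : A.filter (· < x + 1) = A.filter (· < x) :=
      Finset.filter_congr fun y hy => by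
        have := Fin.val_ne_of_ne (ne_of_mem_of_not_mem hy hxA)
        rw [Fin.lt_def, Fin.lt_def, hval]
        lia
    rw [finParity] at hx
    rw [ParityCompatible, finParity, hval, hfilter, Nat.cast_succ, hx, add_assoc,
      show (1 + 1 : ZMod 2) = 0 from rfl, add_zero]

lemma lt_card_parityCompatible {A : Finset (Fin n)} (hn : Odd n)
    (hA : ∀ x ∈ A, ParityCompatible finParity p A x) (hodd : (A.card : ZMod 2) = 1)
    [DecidablePred (ParityCompatible finParity p A)] :
    n < 2 * (Finset.univ.filter (ParityCompatible finParity p A)).card := by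
  obtain ⟨k, rfl⟩ := Nat.exists_eq_add_one_of_ne_zero hn.pos.ne'
  have hk : Even k := by simpa [parity_simps] using hn
  have hle : (Finset.univ.filter fun x => ¬ ParityCompatible finParity p A x).card ≤
      (Finset.univ.filter (ParityCompatible finParity p A)).card :=
    Finset.card_le_card_of_injOn (· + 1) (fun x hx => by
      simpa using parityCompatible_add_one_of_not hk hA hodd (by simpa using hx))
      (add_left_injective 1).injOn
  have hsum := Finset.card_filter_add_card_filter_not (s := Finset.univ)
    (ParityCompatible finParity p A)
  rw [Finset.card_univ, Fintype.card_fin] at hsum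
  obtain ⟨l, rfl⟩ := hk
  lia

open Classical in
/-- Every nonempty `C` has a unique parity core with an odd number of elements, so the intervals
from such a core to the set of all elements compatible with it form a partition. -/
lemma exists_isIntervalPartition_nonempty_of_odd (hn : Odd n) :
    ∃ (ι : Type) (_ : Finite ι) (A B : ι → Finset (Fin n)),
      IsIntervalPartition {C | C.Nonempty} A B ∧ ∀ i, n < 2 * (B i).card := by
  let top (i : ZMod 2 × Finset (Fin n)) : Finset (Fin n) :=
    Finset.univ.filter (ParityCompatible finParity i.1 i.2)
  have subset_top {C : Finset (Fin n)} {i} :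
      C ⊆ top i ↔ ∀ x ∈ C, ParityCompatible finParity i.1 i.2 x := by
    simp [Finset.subset_iff, top]
  refine ⟨{i : ZMod 2 × Finset (Fin n) // i.2 ⊆ top i ∧ (i.2.card : ZMod 2) = 1},
    inferInstance, fun i => i.1.2, fun i => top i.1,
    ⟨fun i => i.2.1, fun i C hC => ?_, fun C hC => ?_⟩,
    fun i => lt_card_parityCompatible hn (subset_top.1 i.2.1) i.2.2⟩
  · have : i.1.2.Nonempty := Finset.nonempty_iff_ne_empty.2 fun h => by simpa [h] using i.2.2
    exact this.mono hC.1
  · obtain ⟨i, ⟨⟨hiC, hi⟩, hodd⟩, huniq⟩ := existsUnique_isParityCore_card_odd finParity hC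
    refine ⟨⟨i, hiC.trans (subset_top.2 hi), hodd⟩, ⟨hiC, subset_top.2 hi⟩, fun j hj => ?_⟩
    exact Subtype.ext (huniq j ⟨⟨hj.1, subset_top.1 hj.2⟩, j.2.2⟩)

lemma exists_map_castSuccEmb_eq {C : Finset (Fin (k + 1))} (hC : Fin.last k ∉ C) :
    ∃ C' : Finset (Fin k), C'.map Fin.castSuccEmb = C := by
  have hsub : C ⊆ Finset.univ.map Fin.castSuccEmb := fun x hx => by
    obtain ⟨y, rfl⟩ := Fin.exists_castSucc_eq.2 (ne_of_mem_of_not_mem hx hC)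
    exact Finset.mem_map_of_mem Fin.castSuccEmb (Finset.mem_univ y)
  obtain ⟨C', -, rfl⟩ := Finset.subset_map_iff.1 hsub
  exact ⟨C', rfl⟩

lemma IsIntervalPartition.nonempty_succ {ι : Type*} {A B : ι → Finset (Fin k)}
    (h : IsIntervalPartition {C | C.Nonempty} A B) :
    IsIntervalPartition {C : Finset (Fin (k + 1)) | C.Nonempty}
      (fun i : Option ι => i.elim {Fin.last k} fun i => (A i).map Fin.castSuccEmb)
      (fun i : Option ι => i.elim Finset.univ fun i => (B i).map Fin.castSuccEmb) where
  le
  | none => Finset.subset_univ _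
  | some i => Finset.map_subset_map.2 (h.le i)
  Icc_subset
  | none => fun _ hC => (Finset.singleton_nonempty _).mono hC.1
  | some i => fun _ hC =>
    (Finset.map_nonempty.2 (h.Icc_subset i ⟨le_rfl, h.le i⟩)).mono hC.1
  existsUnique C hC := by
    by_cases hCl : Fin.last k ∈ C
    · refine ⟨none, ⟨Finset.singleton_subset_iff.2 hCl, Finset.subset_univ _⟩, ?_⟩
      rintro (_ | i) hi
      · rfl
      · exact absurd (hi.2 hCl) (by simp)
    · obtain ⟨C, rfl⟩ := exists_map_castSuccEmb_eq hCl
      obtain ⟨i, hi, huniq⟩ := h.existsUnique C (Finset.map_nonempty.1 hC)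
      refine ⟨some i, ⟨Finset.map_subset_map.2 hi.1, Finset.map_subset_map.2 hi.2⟩, ?_⟩
      rintro (_ | j) hj
      · exact absurd (Finset.singleton_subset_iff.1 hj.1) hCl
      · rw [huniq j ⟨Finset.map_subset_map.1 hj.1, Finset.map_subset_map.1 hj.2⟩]

lemma exists_isIntervalPartition_nonempty (n : ℕ) :
    ∃ (ι : Type) (_ : Finite ι) (A B : ι → Finset (Fin n)),
      IsIntervalPartition {C | C.Nonempty} A B ∧ ∀ i, (n + 1) / 2 ≤ (B i).card := by
  obtain hn | hn := n.even_or_odd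
  · obtain _ | k := n
    · exact ⟨Empty, inferInstance, Empty.elim, Empty.elim, ⟨Empty.rec, Empty.rec, fun C hC =>
        absurd C.eq_empty_of_isEmpty (Finset.Nonempty.ne_empty hC)⟩, Empty.rec⟩
    obtain ⟨ι, _, A, B, hAB, hB⟩ :=
      exists_isIntervalPartition_nonempty_of_odd (n := k) (by simpa [parity_simps] using hn)
    refine ⟨Option ι, inferInstance, _, _, hAB.nonempty_succ, ?_⟩
    rintro (_ | i)
    · simp only [Option.elim_none, Finset.card_univ, Fintype.card_fin]
      lia
    · have := hB i
      simp only [Option.elim_some, Finset.card_map]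
      lia
  · obtain ⟨ι, hι, A, B, hAB, hB⟩ := exists_isIntervalPartition_nonempty_of_odd hn
    exact ⟨ι, hι, A, B, hAB, fun i => by have := hB i; lia⟩

end IntervalPartitions

section RegularSequences

open RingTheory.Sequence Pointwise

variable {A : Type*} [CommRing A] {M : Type v} [AddCommGroup M] [Module A M]

lemma exists_sum_smul_eq_of_mem_span_range_smul_top {ι : Type*} [Fintype ι] {l : ι → A} {x : M}
    (hx : x ∈ (Ideal.span (Set.range l) • ⊤ : Submodule A M)) :
    ∃ z : ι → M, ∑ i, l i • z i = x := by
  classical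
  induction hx using Submodule.smul_induction_on' with
  | smul a ha y _ =>
    obtain ⟨c, rfl⟩ := Ideal.mem_span_range_iff_exists_fun.1 ha
    exact ⟨fun i => c i • y, by simp only [Finset.sum_smul, smul_smul, mul_comm]⟩
  | add _ _ _ _ hx hy =>
    obtain ⟨z, rfl⟩ := hx
    obtain ⟨w, rfl⟩ := hy
    exact ⟨z + w, by simp only [Pi.add_apply, smul_add, Finset.sum_add_distrib]⟩

lemma ofList_ofFn {n : ℕ} (l : Fin n → A) :
    Ideal.ofList (List.ofFn l) = Ideal.span (Set.range l) := by
  simp only [Ideal.ofList, List.mem_ofFn', Set.ofPred_mem_eq]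

lemma mem_span_range_smul_top_of_sum_smul_eq_zero {n : ℕ} {l : Fin n → A}
    (hl : IsWeaklyRegular M (List.ofFn l)) {x : Fin n → M} (hx : ∑ i, l i • x i = 0) (i : Fin n) :
    x i ∈ (Ideal.span (Set.range l) • ⊤ : Submodule A M) := by
  induction n with
  | zero => exact i.elim0
  | succ n ih =>
    rw [List.ofFn_succ', List.concat_eq_append, isWeaklyRegular_append_iff,
      isWeaklyRegular_singleton_iff, ofList_ofFn] at hl
    rw [Fin.sum_univ_castSucc] at hx
    have hmono : Ideal.span (Set.range fun i : Fin n => l i.castSucc) ≤ Ideal.span (Set.range l) :=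
      Ideal.span_mono (Set.range_comp_subset_range Fin.castSucc l)
    have hlast : x (Fin.last n) ∈
        (Ideal.span (Set.range fun i : Fin n => l i.castSucc) • ⊤ : Submodule A M) := by
      refine mem_of_isSMulRegular_quotient_of_smul_mem hl.2 ?_
      rw [← neg_eq_of_add_eq_zero_right hx]
      exact neg_mem (sum_mem fun i _ => Submodule.smul_mem_smul
        (Ideal.subset_span (Set.mem_range_self i)) Submodule.mem_top)
    obtain ⟨z, hz⟩ := exists_sum_smul_eq_of_mem_span_range_smul_top hlast
    have hinit : ∑ i : Fin n, l i.castSucc • (x i.castSucc + l (Fin.last n) • z i) = 0 := by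
      rw [← hx, ← hz]
      simp only [smul_add, Finset.sum_add_distrib, Finset.smul_sum, smul_comm (l (Fin.last n))]
    refine Fin.lastCases (Submodule.smul_mono_left hmono hlast) (fun i => ?_) i
    have hi := Submodule.smul_mono_left hmono (ih hl.1 hinit i)
    exact (Submodule.add_mem_iff_left _ (Submodule.smul_mem_smul
      (Ideal.subset_span (Set.mem_range_self _)) Submodule.mem_top)).1 hi

/-- Reductions of a module modulo two ring elements commute. -/
noncomputable def quotSMulTopComm (r s : A) (M : Type*) [AddCommGroup M] [Module A M] :
    QuotSMulTop r (QuotSMulTop s M) ≃ₗ[A] QuotSMulTop s (QuotSMulTop r M) :=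
  QuotSMulTop.equivQuotTensor r _ ≪≫ₗ
    QuotSMulTop.tensorQuotSMulTopEquivQuotSMulTop s _ M ≪≫ₗ
    QuotSMulTop.congr s (QuotSMulTop.equivQuotTensor r M).symm

lemma isSMulRegular_quotSMulTop_swap {r s : A} (hr : IsSMulRegular M r)
    (hs : IsSMulRegular (QuotSMulTop r M) s) : IsSMulRegular (QuotSMulTop s M) r := by
  refine (isSMulRegular_quotient_iff_mem_of_smul_mem _ _).2 fun x hx => ?_
  obtain ⟨y, -, hy⟩ := (Submodule.mem_smul_pointwise_iff_exists _ _ _).1 hx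
  have hy' : y ∈ r • (⊤ : Submodule A M) := by
    refine mem_of_isSMulRegular_quotient_of_smul_mem hs ?_
    rw [hy]
    exact Submodule.smul_mem_pointwise_smul x r ⊤ trivial
  obtain ⟨z, -, rfl⟩ := (Submodule.mem_smul_pointwise_iff_exists _ _ _).1 hy'
  obtain rfl : x = s • z := hr (hy.symm.trans (smul_comm s r z))
  exact Submodule.smul_mem_pointwise_smul z s ⊤ trivial

variable {F : Type*} [Field F] [Infinite F] [Algebra F A]

lemma exists_mem_subspace_forall_notMem_ideal (V : Submodule F A) {T : Set (Ideal A)}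
    (hT : T.Finite) (hTV : ∀ p ∈ T, ¬ Ideal.span (V : Set A) ≤ p) : ∃ l ∈ V, ∀ p ∈ T, l ∉ p := by
  classical
  let s : Finset (Submodule F V) :=
    hT.toFinset.image fun p => (p.restrictScalars F).comap V.subtype
  have hs : ⊤ ∉ s := by
    intro h
    obtain ⟨p, hp, hpt⟩ := Finset.mem_image.1 h
    exact hTV p (hT.mem_toFinset.1 hp) (Ideal.span_le.2 (Submodule.comap_subtype_eq_top.1 hpt))
  obtain ⟨l, hl⟩ := (Set.ne_univ_iff_exists_notMem _).1
    (Subspace.biUnion_ne_univ_of_top_notMem hs)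
  exact ⟨l, l.2, fun p hp hlp => hl (Set.mem_biUnion (x := (p.restrictScalars F).comap V.subtype)
    (Finset.mem_coe.2 (Finset.mem_image_of_mem _ (hT.mem_toFinset.2 hp))) hlp)⟩

variable [IsNoetherianRing A]

lemma isSMulRegular_iff_forall_notMem_associatedPrimes {l : A} :
    IsSMulRegular M l ↔ ∀ p ∈ associatedPrimes A M, l ∉ p := by
  simpa using (Set.ext_iff.1 (biUnion_associatedPrimes_eq_compl_regular A M) l).symm.not

/-- By induction on the sequence one may always avoid the associated primes of the module itself
and pass to a quotient, since regular elements can be moved past `l`. -/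
lemma exists_finite_ideals_isWeaklyRegular_cons {J : Ideal A} {f : A} (hf : f ∈ J) {rs : List A}
    (hrs : ∀ g ∈ rs, g ∈ J) [Module.Finite A M] (h : IsWeaklyRegular M (rs ++ [f])) :
    ∃ T : Set (Ideal A), T.Finite ∧ (∀ p ∈ T, ¬ J ≤ p) ∧
      ∀ l, (∀ p ∈ T, l ∉ p) → IsWeaklyRegular M (l :: rs) := by
  induction rs generalizing M with
  | nil =>
    rw [List.nil_append, isWeaklyRegular_singleton_iff,
      isSMulRegular_iff_forall_notMem_associatedPrimes] at h
    refine ⟨associatedPrimes A M, associatedPrimes.finite A M, fun p hp hJ => h p hp (hJ hf),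
      fun l hl => ?_⟩
    exact (isWeaklyRegular_singleton_iff M l).2
      (isSMulRegular_iff_forall_notMem_associatedPrimes.2 hl)
  | cons g rs ih =>
    rw [List.forall_mem_cons] at hrs
    rw [List.cons_append, isWeaklyRegular_cons_iff] at h
    obtain ⟨T, hT, hTJ, hTl⟩ := ih hrs.2 h.2
    refine ⟨associatedPrimes A M ∪ T, (associatedPrimes.finite A M).union hT, ?_, fun l hl => ?_⟩
    · rintro p (hp | hp)
      · exact fun hJ => isSMulRegular_iff_forall_notMem_associatedPrimes.1 h.1 p hp (hJ hrs.1)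
      · exact hTJ p hp
    · have hlg := (isWeaklyRegular_cons_iff _ _ _).1 (hTl l fun p hp => hl p (Or.inr hp))
      rw [isWeaklyRegular_cons_iff, isWeaklyRegular_cons_iff]
      exact ⟨isSMulRegular_iff_forall_notMem_associatedPrimes.2 fun p hp => hl p (Or.inl hp),
        isSMulRegular_quotSMulTop_swap h.1 hlg.1,
        ((quotSMulTopComm l g M).isWeaklyRegular_congr rs).1 hlg.2⟩

lemma exists_isWeaklyRegular_mem_subspace (V : Submodule F A) [Module.Finite A M] {rs : List A}
    (hrs : ∀ f ∈ rs, f ∈ Ideal.span (V : Set A)) (h : IsWeaklyRegular M rs) :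
    ∃ l : Fin rs.length → A, (∀ i, l i ∈ V) ∧ IsWeaklyRegular M (List.ofFn l) := by
  induction hd : rs.length generalizing M rs with
  | zero => exact ⟨Fin.elim0, fun i => i.elim0, by simp⟩
  | succ d ih =>
    obtain rfl | ⟨rs, f, rfl⟩ := rs.eq_nil_or_concat'
    · simp at hd
    simp only [List.forall_mem_append, List.forall_mem_singleton] at hrs
    obtain ⟨T, hT, hTJ, hTl⟩ := exists_finite_ideals_isWeaklyRegular_cons hrs.2 hrs.1 h
    obtain ⟨l, hlV, hlT⟩ := exists_mem_subspace_forall_notMem_ideal V hT hTJ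
    obtain ⟨hl, hls⟩ := (isWeaklyRegular_cons_iff _ _ _).1 (hTl l hlT)
    obtain ⟨ls, hlsV, hls⟩ := ih hrs.1 hls (by simpa using hd)
    refine ⟨Fin.cons l ls, Fin.cases hlV hlsV, ?_⟩
    rw [List.ofFn_cons, isWeaklyRegular_cons_iff]
    exact ⟨hl, hls⟩

/-- Over an infinite field, the sequence may be assumed to lie in `V`. As relations between its
members have coefficients in `V • M`, multiplying by it embeds a power of `W` into `W'`. -/
lemma length_mul_finrank_le_of_disjoint [Module F M] [IsScalarTower F A M] [Module.Finite A M]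
    (V : Submodule F A) {W W' : Submodule F M} [Module.Finite F W] [Module.Finite F W']
    (hW : ∀ w ∈ W, w ∈ (Ideal.span (V : Set A) • ⊤ : Submodule A M) → w = 0)
    (hVW : ∀ v ∈ V, ∀ w ∈ W, v • w ∈ W') {rs : List A}
    (hrs : ∀ f ∈ rs, f ∈ Ideal.span (V : Set A)) (h : IsWeaklyRegular M rs) :
    rs.length * Module.finrank F W ≤ Module.finrank F W' := by
  obtain ⟨l, hlV, hl⟩ := exists_isWeaklyRegular_mem_subspace V hrs h
  let T : (Fin rs.length → W) →ₗ[F] M :=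
    ∑ i, Algebra.lsmul F F M (l i) ∘ₗ W.subtype ∘ₗ LinearMap.proj i
  have hT_apply (x) : T x = ∑ i, l i • (x i : M) := by simp [T, LinearMap.sum_apply]
  have hT : Function.Injective T := by
    rw [← LinearMap.ker_eq_bot, LinearMap.ker_eq_bot']
    intro x hx
    ext i
    have hmem := mem_span_range_smul_top_of_sum_smul_eq_zero hl (x := fun i => (x i : M))
      (by rw [← hT_apply, hx]) i
    exact hW _ (x i).2 (Submodule.smul_mono_left
      (Ideal.span_mono (Set.range_subset_iff.2 hlV)) hmem)
  have hTW : LinearMap.range T ≤ W' := by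
    rintro _ ⟨x, rfl⟩
    rw [hT_apply]
    exact sum_mem fun i _ => hVW _ (hlV i) _ (x i).2
  calc rs.length * Module.finrank F W = Module.finrank F (LinearMap.range T) := by
        rw [LinearMap.finrank_range_of_inj hT, Module.finrank_pi_fintype]
        simp
    _ ≤ Module.finrank F W' := Submodule.finrank_mono hTW

end RegularSequences

section GradedModules

variable {K : Type u} [Field K] {σ : Type*} {N : Type v} [AddCommGroup N] [Module K N]
  [Module (MvPolynomial σ K) N] {𝒩 : ℤ → Submodule K N}

lemma IsGradedModule.X_smul_mem (h : IsGradedModule (σ := σ) 𝒩) (s : σ) {j : ℤ} {x : N}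
    (hx : x ∈ 𝒩 j) : (X s : MvPolynomial σ K) • x ∈ 𝒩 (1 + j) := by
  simpa only [Nat.cast_one] using h.smul_mem 1 j (X s) x (isHomogeneous_X K s) hx

lemma monomial_one_smul_mem
    (hX : ∀ (s : σ) (j : ℤ), ∀ x ∈ 𝒩 j, (X s : MvPolynomial σ K) • x ∈ 𝒩 (1 + j))
    (e : σ →₀ ℕ) {j : ℤ} {x : N} (hx : x ∈ 𝒩 j) :
    (monomial e (1 : K)) • x ∈ 𝒩 (e.degree + j) := by
  induction e using Finsupp.induction_linear generalizing j x with
  | zero => simpa using hx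
  | add e e' he he' =>
    rw [← mul_one (1 : K), ← monomial_mul, mul_smul, map_add, Nat.cast_add, add_assoc]
    exact he (he' hx)
  | single s d =>
    rw [← X_pow_eq_monomial, Finsupp.degree_single]
    induction d with
    | zero => simpa using hx
    | succ d ih =>
      rw [pow_succ', mul_smul, Nat.cast_succ, add_comm (d : ℤ), add_assoc]
      exact hX s _ _ ih

lemma eq_zero_of_mem_iSup_gt (h : DirectSum.IsInternal 𝒩) {j : ℤ} {x : N} (hx : x ∈ 𝒩 j)
    (hx' : x ∈ ⨆ i > j, 𝒩 i) : x = 0 :=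
  Submodule.disjoint_def.1 (h.submodule_iSupIndep j) x hx
    ((biSup_mono fun _ hi => hi.ne' : ⨆ i > j, 𝒩 i ≤ ⨆ i ≠ j, 𝒩 i) hx')

lemma IsGradedModule.X_smul_mem_iSup_gt (h : IsGradedModule (σ := σ) 𝒩) {c : ℤ}
    (hbot : ∀ j < c, 𝒩 j = ⊥) (s : σ) (x : N) :
    (X s : MvPolynomial σ K) • x ∈ ⨆ i > c, 𝒩 i := by
  have hx : x ∈ ⨆ i, 𝒩 i := h.isInternal.submodule_iSup_eq_top ▸ Submodule.mem_top
  induction hx using Submodule.iSup_induction' with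
  | zero => simp
  | add x y _ _ hx hy => exact smul_add (X s : MvPolynomial σ K) x y ▸ add_mem hx hy
  | mem j x hx =>
    obtain hj | hj := lt_or_ge j c
    · rw [hbot j hj, Submodule.mem_bot] at hx
      simp [hx]
    · exact Submodule.mem_iSup_of_mem (1 + j) (Submodule.mem_iSup_of_mem (by lia)
        (h.X_smul_mem s hx))

variable [IsScalarTower K (MvPolynomial σ K) N]

lemma IsGradedModule.of_X_smul_mem (h : DirectSum.IsInternal 𝒩)
    (hX : ∀ (s : σ) (j : ℤ), ∀ x ∈ 𝒩 j, (X s : MvPolynomial σ K) • x ∈ 𝒩 (1 + j)) :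
    IsGradedModule (σ := σ) 𝒩 where
  isInternal := h
  smul_mem i j p x hp hx := by
    rw [p.as_sum, Finset.sum_smul]
    refine sum_mem fun e he => ?_
    obtain rfl : e.degree = i := by
      rw [Finsupp.degree_eq_weight_one]
      exact hp (mem_support_iff.1 he)
    rw [← mul_one (coeff e p), ← smul_eq_mul, ← smul_monomial, smul_assoc]
    exact Submodule.smul_mem _ _ (monomial_one_smul_mem hX e hx)

lemma IsGradedModule.smul_sub_coeff_zero_smul_mem (h : IsGradedModule (σ := σ) 𝒩) {j : ℤ} {x : N}
    (hx : x ∈ 𝒩 j) (p : MvPolynomial σ K) : p • x - coeff 0 p • x ∈ ⨆ i > j, 𝒩 i := by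
  induction p using MvPolynomial.induction_on' with
  | add p q hp hq =>
    rw [add_smul, coeff_add, add_smul, add_sub_add_comm]
    exact add_mem hp hq
  | monomial e a =>
    classical
    obtain rfl | he := eq_or_ne e 0
    · rw [coeff_monomial, if_pos rfl, ← C_apply, ← algebraMap_eq, algebraMap_smul, sub_self]
      exact zero_mem _
    · rw [coeff_monomial, if_neg he, zero_smul, sub_zero]
      have hpos : 0 < e.degree := Nat.pos_of_ne_zero (mt (Finsupp.degree_eq_zero_iff e).1 he)
      exact Submodule.mem_iSup_of_mem (e.degree + j) (Submodule.mem_iSup_of_mem (by lia)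
        (h.smul_mem _ _ _ _ (isHomogeneous_monomial a rfl) hx))

/-- Modulo higher degrees, a polynomial acts on `𝒩 j` by its constant coefficient, so generators
in `𝒩 j` of the submodule generated by `𝒩 j` span `𝒩 j` over `K`. -/
lemma IsGradedModule.finite_component [Finite σ] [Module.Finite (MvPolynomial σ K) N]
    (h : IsGradedModule (σ := σ) 𝒩) (j : ℤ) : Module.Finite K (𝒩 j) := by
  have hfg : (Submodule.span (MvPolynomial σ K) (𝒩 j : Set N)).FG := IsNoetherian.noetherian _
  obtain ⟨s, hs, hspan⟩ := Submodule.fg_span_iff_fg_span_finset_subset _ |>.1 hfg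
  refine Module.Finite.iff_fg.2 ⟨s, le_antisymm (Submodule.span_le.2 hs) fun x hx => ?_⟩
  obtain ⟨f, -, hf⟩ := Submodule.mem_span_finset.1 (hspan ▸ Submodule.subset_span hx)
  have hsum : ∑ y ∈ s, coeff 0 (f y) • y ∈ Submodule.span K (s : Set N) :=
    sum_mem fun y hy => Submodule.smul_mem _ _ (Submodule.subset_span hy)
  have hhigh : x - ∑ y ∈ s, coeff 0 (f y) • y ∈ ⨆ i > j, 𝒩 i := by
    rw [← hf, ← Finset.sum_sub_distrib]
    exact sum_mem fun y hy => h.smul_sub_coeff_zero_smul_mem (hs hy) (f y)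
  rw [sub_eq_zero.1 (eq_zero_of_mem_iSup_gt h.isInternal
    (sub_mem hx (Submodule.span_le.2 hs hsum)) hhigh)]
  exact hsum

open RingTheory.Sequence

lemma IsGradedModule.length_mul_finrank_le_of_infinite [Infinite K] [Finite σ]
    [Module.Finite (MvPolynomial σ K) N] (h : IsGradedModule (σ := σ) 𝒩) {c : ℤ}
    (hbot : ∀ j < c, 𝒩 j = ⊥) {rs : List (MvPolynomial σ K)}
    (hrs : ∀ f ∈ rs, f ∈ Ideal.span (Set.range (X : σ → MvPolynomial σ K)))
    (hreg : IsWeaklyRegular N rs) :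
    rs.length * Module.finrank K (𝒩 c) ≤ Module.finrank K (𝒩 (1 + c)) := by
  have := h.finite_component
  have := Fintype.ofFinite σ
  rw [Ideal.span, ← Submodule.span_span_of_tower K] at hrs
  refine length_mul_finrank_le_of_disjoint (Submodule.span K (Set.range X)) (fun x hx hx' => ?_)
    (fun v hv x hx => ?_) hrs hreg
  · rw [Ideal.span, Submodule.span_span_of_tower K] at hx'
    obtain ⟨z, hz⟩ := exists_sum_smul_eq_of_mem_span_range_smul_top hx'
    refine eq_zero_of_mem_iSup_gt h.isInternal hx ?_
    rw [← hz]
    exact sum_mem fun s _ => h.X_smul_mem_iSup_gt hbot s (z s)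
  · induction hv using Submodule.span_induction with
    | mem v hv =>
      obtain ⟨s, rfl⟩ := hv
      exact h.X_smul_mem s hx
    | zero => simp
    | add v w _ _ hv hw => exact add_smul v w x ▸ add_mem hv hw
    | smul a v _ hv => exact smul_assoc a v x ▸ Submodule.smul_mem _ a hv

section BaseChange

open TensorProduct

attribute [local instance] algebraMvPolynomial

variable (F : Type*) [Field F] [Algebra K F]

variable (K σ N) in
/-- Extending scalars from `K[σ]` to `F[σ]` is extending scalars from `K` to `F`. -/
noncomputable def polynomialBaseChangeEquiv :
    MvPolynomial σ F ⊗[MvPolynomial σ K] N ≃ₗ[F] F ⊗[K] N :=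
  Algebra.IsPushout.cancelBaseChange K F (MvPolynomial σ K) (MvPolynomial σ F) N

/-- The grading of the extension of scalars of a graded module to polynomials over `F`. -/
noncomputable def baseChangeGrading (𝒩 : ℤ → Submodule K N) (j : ℤ) :
    Submodule F (MvPolynomial σ F ⊗[MvPolynomial σ K] N) :=
  ((𝒩 j).baseChange F).map (polynomialBaseChangeEquiv K σ N F).symm.toLinearMap

lemma isInternal_baseChangeGrading (h : DirectSum.IsInternal 𝒩) :
    DirectSum.IsInternal (baseChangeGrading F (σ := σ) 𝒩) := by
  have hF := h.baseChange 𝒩 (S := F)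
  refine (DirectSum.isInternal_submodule_iff_iSupIndep_and_iSup_eq_top _).2
    ⟨hF.submodule_iSupIndep.map_orderIso (Submodule.orderIsoMapComap
      (polynomialBaseChangeEquiv K σ N F).symm), ?_⟩
  change ⨆ j, Submodule.map _ _ = ⊤
  rw [← Submodule.map_iSup, hF.submodule_iSup_eq_top, Submodule.map_top, LinearEquiv.range]

lemma X_smul_polynomialBaseChangeEquiv_symm_tmul (s : σ) (a : F) (x : N) :
    (X s : MvPolynomial σ F) • (polynomialBaseChangeEquiv K σ N F).symm (a ⊗ₜ x) =
      (polynomialBaseChangeEquiv K σ N F).symm (a ⊗ₜ ((X s : MvPolynomial σ K) • x)) := by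
  have hX : (X s : MvPolynomial σ F) = algebraMap (MvPolynomial σ K) (MvPolynomial σ F) (X s) := by
    rw [MvPolynomial.algebraMap_def, map_X]
  rw [polynomialBaseChangeEquiv, Algebra.IsPushout.cancelBaseChange_symm_tmul,
    Algebra.IsPushout.cancelBaseChange_symm_tmul, hX, algebraMap_smul, TensorProduct.tmul_smul]

lemma IsGradedModule.baseChange (h : IsGradedModule (σ := σ) 𝒩) :
    IsGradedModule (σ := σ) (baseChangeGrading F (σ := σ) 𝒩) := by
  refine .of_X_smul_mem (isInternal_baseChangeGrading F h.isInternal) fun s j y hy => ?_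
  obtain ⟨_, hz, rfl⟩ := hy
  obtain ⟨z, rfl⟩ := Submodule.toBaseChange_surjective' F (𝒩 j) hz
  induction z with
  | zero => simp
  | add z w hz' hw' =>
    simp only [map_add, Submodule.coe_add, smul_add]
    exact add_mem (hz' (Submodule.coe_mem _)) (hw' (Submodule.coe_mem _))
  | tmul a x =>
    have hx := X_smul_polynomialBaseChangeEquiv_symm_tmul (K := K) F s a (x : N)
    exact ⟨a ⊗ₜ ((X s : MvPolynomial σ K) • (x : N)),
      Submodule.tmul_mem_baseChange_of_mem a (h.X_smul_mem s x.2), hx.symm⟩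

lemma hilbertSeries_baseChangeGrading (h : DirectSum.IsInternal 𝒩) :
    hilbertSeries (baseChangeGrading F (σ := σ) 𝒩) = hilbertSeries 𝒩 := by
  ext j
  rw [hilbertSeries, baseChangeGrading, LinearEquiv.finrank_map_eq,
    ← (LinearEquiv.ofBijective _ (h.toBaseChange_bijective 𝒩 (S := F) j)).finrank_eq,
    Module.finrank_baseChange, hilbertSeries]

lemma IsGradedModule.length_mul_hilbertSeries_le [Finite σ] [Module.Finite (MvPolynomial σ K) N]
    (h : IsGradedModule (σ := σ) 𝒩) {c : ℤ} (hbot : ∀ j < c, 𝒩 j = ⊥)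
    {rs : List (MvPolynomial σ K)}
    (hrs : ∀ f ∈ rs, f ∈ Ideal.span (Set.range (X : σ → MvPolynomial σ K)))
    (hreg : IsWeaklyRegular N rs) :
    rs.length * hilbertSeries 𝒩 c ≤ hilbertSeries 𝒩 (1 + c) := by
  let F := AlgebraicClosure K
  have : Infinite F := IsAlgClosed.instInfinite
  have : Module.Flat (MvPolynomial σ K) (MvPolynomial σ F) :=
    Module.Flat.isBaseChange K (MvPolynomial σ K) F (MvPolynomial σ F) Algebra.IsPushout.out
  have hreg' := hreg.of_flat_of_isBaseChange
    (TensorProduct.isBaseChange (MvPolynomial σ K) N (MvPolynomial σ F))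
  rw [← hilbertSeries_baseChangeGrading F (σ := σ) h.isInternal, ← List.length_map]
  refine (h.baseChange F).length_mul_finrank_le_of_infinite (fun j hj => ?_) (fun f hf => ?_) hreg'
  · rw [baseChangeGrading, hbot j hj, Submodule.baseChange_bot, Submodule.map_bot]
  · obtain ⟨g, hg, rfl⟩ := List.mem_map.1 hf
    have hmap := Ideal.mem_map_of_mem (algebraMap (MvPolynomial σ K) (MvPolynomial σ F)) (hrs g hg)
    simpa only [Ideal.map_span, ← Set.range_comp, Function.comp_def, MvPolynomial.algebraMap_def,
      map_X] using hmap

end BaseChange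

end GradedModules

section RegularSequencesOfVariables

open RingTheory.Sequence

variable {A : Type*} [CommRing A] {ι : Type*} [Finite ι] {M : ι → Type*}
  [∀ i, AddCommGroup (M i)] [∀ i, Module A (M i)]

lemma mem_smul_top_pi_iff {J : Ideal A} {f : ∀ i, M i} :
    f ∈ (J • ⊤ : Submodule A (∀ i, M i)) ↔ ∀ i, f i ∈ (J • ⊤ : Submodule A (M i)) := by
  classical
  have := Fintype.ofFinite ι
  refine ⟨fun hf i => ?_, fun hf => ?_⟩
  · have hi := Submodule.mem_map_of_mem (f := LinearMap.proj i) hf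
    rw [Submodule.map_smul''] at hi
    exact Submodule.smul_mono le_rfl le_top hi
  · rw [← Finset.univ_sum_single f]
    refine sum_mem fun i _ => ?_
    have hi := Submodule.mem_map_of_mem (f := LinearMap.single A M i) (hf i)
    rw [Submodule.map_smul''] at hi
    exact Submodule.smul_mono le_rfl le_top hi

lemma isWeaklyRegular_pi {rs : List A} (h : ∀ i, IsWeaklyRegular (M i) rs) :
    IsWeaklyRegular (∀ i, M i) rs where
  regular_mod_prev t ht := by
    rw [isSMulRegular_quotient_iff_mem_of_smul_mem]
    intro f hf
    rw [mem_smul_top_pi_iff] at hf ⊢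
    exact fun i => mem_of_isSMulRegular_quotient_of_smul_mem ((h i).regular_mod_prev t ht) (hf i)

variable {R σ : Type*} [CommRing R]

lemma ofList_map_X (l : List σ) :
    Ideal.ofList (l.map X) = Ideal.span (X '' {s | s ∈ l} : Set (MvPolynomial σ R)) := by
  simp only [Ideal.ofList, List.mem_map]
  rfl

lemma mem_span_X_image_of_X_mul_mem {t : Set σ} {s : σ} (hs : s ∉ t) {f : MvPolynomial σ R}
    (hf : X s * f ∈ Ideal.span (X '' t)) : f ∈ Ideal.span (X '' t) := by
  classical
  rw [mem_ideal_span_X_image] at hf ⊢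
  intro e he
  have he' : Finsupp.single s 1 + e ∈ (X s * f).support := by
    rwa [mem_support_iff, coeff_X_mul, ← mem_support_iff]
  obtain ⟨i, hi, hne⟩ := hf _ he'
  refine ⟨i, hi, ?_⟩
  rwa [Finsupp.add_apply, Finsupp.single_eq_of_ne (by rintro rfl; exact hs hi), zero_add] at hne

lemma isWeaklyRegular_map_X {l : List σ} (hl : l.Nodup) :
    IsWeaklyRegular (MvPolynomial σ R) (l.map (X : σ → MvPolynomial σ R)) where
  regular_mod_prev t ht := by
    rw [isSMulRegular_quotient_iff_mem_of_smul_mem, List.getElem_map, ← List.map_take, ofList_map_X,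
      smul_eq_mul, Ideal.mul_top]
    intro f hf
    refine mem_span_X_image_of_X_mul_mem (fun hmem => ?_) hf
    rw [List.length_map] at ht
    obtain ⟨t', ht', heq⟩ := List.mem_take_iff_getElem.1 hmem
    rw [hl.getElem_inj_iff] at heq
    omega

end RegularSequencesOfVariables

section TruncatedPolynomials

variable {K : Type u} [Field K] {k d : ℕ}

variable (K k d) in
/-- The map of polynomial rings setting all but the first `d` of `k` variables to zero. -/
noncomputable def truncHom : MvPolynomial (Fin k) K →ₐ[K] MvPolynomial (Fin d) K :=
  aeval fun s => if h : (s : ℕ) < d then X ⟨s, h⟩ else 0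

lemma truncHom_X_of_lt {s : Fin k} (h : (s : ℕ) < d) : truncHom K k d (X s) = X ⟨s, h⟩ := by
  rw [truncHom, aeval_X, dif_pos h]

lemma truncHom_X_of_le {s : Fin k} (h : d ≤ (s : ℕ)) : truncHom K k d (X s) = 0 := by
  rw [truncHom, aeval_X, dif_neg h.not_gt]

lemma truncHom_surjective (hd : d ≤ k) : Function.Surjective (truncHom K k d) := by
  intro p
  refine ⟨rename (Fin.castLE hd) p, ?_⟩
  have hX : (truncHom K k d).comp (rename (Fin.castLE hd)) = AlgHom.id K _ := by
    ext s : 1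
    rw [AlgHom.comp_apply, rename_X, truncHom_X_of_lt (by simp)]
    rfl
  exact DFunLike.congr_fun hX p

/-- The polynomial ring in `d` variables, as an algebra over the polynomial ring in `k` variables
through `truncHom`. The parameter `k` only serves to select this algebra structure. -/
def TruncPoly (K : Type u) [Field K] (_k d : ℕ) : Type u := MvPolynomial (Fin d) K

noncomputable instance : CommRing (TruncPoly K k d) :=
  inferInstanceAs (CommRing (MvPolynomial (Fin d) K))

noncomputable instance : Algebra K (TruncPoly K k d) :=
  inferInstanceAs (Algebra K (MvPolynomial (Fin d) K))

noncomputable instance : Algebra (MvPolynomial (Fin k) K) (TruncPoly K k d) :=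
  (truncHom K k d).toAlgebra

instance : IsScalarTower K (MvPolynomial (Fin k) K) (TruncPoly K k d) :=
  .of_algebraMap_eq fun c => ((truncHom K k d).commutes c).symm

/-- The underlying polynomial in `d` variables. -/
noncomputable def TruncPoly.toPoly : TruncPoly K k d ≃ₐ[K] MvPolynomial (Fin d) K :=
  AlgEquiv.refl

lemma TruncPoly.toPoly_smul (p : MvPolynomial (Fin k) K) (f : TruncPoly K k d) :
    (p • f).toPoly = truncHom K k d p * f.toPoly := rfl

lemma TruncPoly.finite (hd : d ≤ k) : Module.Finite (MvPolynomial (Fin k) K) (TruncPoly K k d) :=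
  Module.Finite.of_surjective (Algebra.linearMap _ _) (truncHom_surjective hd)

variable (K) in
/-- The first `q` of `k` variables. -/
noncomputable def initialVariables {q : ℕ} (hqk : q ≤ k) : List (MvPolynomial (Fin k) K) :=
  (List.ofFn (Fin.castLE hqk)).map X

lemma map_truncHom_initialVariables {q : ℕ} (hqk : q ≤ k) (hqd : q ≤ d) :
    (initialVariables K hqk).map (truncHom K k d) = initialVariables K hqd := by
  refine List.ext_getElem (by simp [initialVariables]) fun t ht _ => ?_
  simp only [initialVariables, List.getElem_map, List.getElem_ofFn]
  exact truncHom_X_of_lt _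

open RingTheory.Sequence in
lemma isRegular_initialVariables {q : ℕ} (hqk : q ≤ k) (hqd : q ≤ d) :
    IsRegular (TruncPoly K k d) (initialVariables K hqk) where
  toIsWeaklyRegular := by
    rw [← isWeaklyRegular_map_algebraMap_iff (TruncPoly K k d) (TruncPoly K k d)]
    change IsWeaklyRegular (MvPolynomial (Fin d) K) ((initialVariables K hqk).map (truncHom K k d))
    rw [map_truncHom_initialVariables hqk hqd]
    exact isWeaklyRegular_map_X (List.nodup_ofFn.2 (Fin.castLE_injective hqd))
  top_ne_smul h := by
    rw [Ideal.smul_top_eq_map, Ideal.map_ofList] at h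
    have hmem : (1 : MvPolynomial (Fin d) K) ∈
        Ideal.ofList ((initialVariables K hqk).map (truncHom K k d)) := h.le Submodule.mem_top
    rw [map_truncHom_initialVariables hqk hqd, initialVariables, ofList_map_X,
      mem_ideal_span_X_image] at hmem
    obtain ⟨_, _, hne⟩ := hmem 0 (by simp)
    exact hne rfl

end TruncatedPolynomials

section TruncatedSums

variable {K : Type u} [Field K] {k : ℕ} {ι : Type} {d : ι → ℕ}

variable (K k d) in
/-- The monomial basis of a direct sum of truncated polynomial rings. -/
noncomputable def truncBasis [Fintype ι] :
    Module.Basis (Σ i, Fin (d i) →₀ ℕ) K (∀ i, TruncPoly K k (d i)) :=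
  Pi.basis fun i => (basisMonomials (Fin (d i)) K).map TruncPoly.toPoly.symm.toLinearEquiv

lemma truncBasis_repr [Fintype ι] (f : ∀ i, TruncPoly K k (d i)) (p : Σ i, Fin (d i) →₀ ℕ) :
    (truncBasis K k d).repr f p = coeff p.2 (f p.1).toPoly := by
  rw [truncBasis, Pi.basis_repr]
  rfl

lemma isGradedModule_basisPart_truncBasis [Fintype ι] (a : ι → ℕ) :
    IsGradedModule (σ := Fin k)
      (basisPart (truncBasis K k d) fun p => ((a p.1 + p.2.degree : ℕ) : ℤ)) := by
  classical
  refine .of_X_smul_mem (isInternal_basisPart _ _) fun s j f hf => ?_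
  rw [mem_basisPart_iff] at hf ⊢
  rintro ⟨i, e⟩ he
  rw [truncBasis_repr, Pi.smul_apply, TruncPoly.toPoly_smul]
  rcases lt_or_ge (s : ℕ) (d i) with hs | hs
  · rw [truncHom_X_of_lt hs]
    by_cases hle : Finsupp.single ⟨s, hs⟩ 1 ≤ e
    · obtain ⟨e', rfl⟩ := exists_add_of_le hle
      rw [coeff_X_mul, ← truncBasis_repr f ⟨i, e'⟩]
      refine hf ⟨i, e'⟩ fun h => he ?_
      rw [map_add, Finsupp.degree_single, ← h]
      push_cast
      ring
    · rw [coeff_X_mul', if_neg]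
      rwa [Finsupp.mem_support_iff, ← Nat.one_le_iff_ne_zero, ← Finsupp.single_le_iff]
  · rw [truncHom_X_of_le hs, zero_mul, coeff_zero]

lemma isRegular_pi_initialVariables [Finite ι] [Nonempty ι] {q : ℕ} (hqk : q ≤ k)
    (hd : ∀ i, q ≤ d i) :
    RingTheory.Sequence.IsRegular (∀ i, TruncPoly K k (d i)) (initialVariables K hqk) where
  toIsWeaklyRegular :=
    isWeaklyRegular_pi fun i => (isRegular_initialVariables hqk (hd i)).toIsWeaklyRegular
  top_ne_smul h := by
    classical
    obtain ⟨i⟩ := ‹Nonempty ι›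
    refine (isRegular_initialVariables (K := K) hqk (hd i)).top_ne_smul
      (eq_top_iff.2 fun x _ => ?_).symm
    have hf := mem_smul_top_pi_iff.1 (h.le (Submodule.mem_top (x := Pi.single i x))) i
    rwa [Pi.single_eq_same (M := fun i => TruncPoly K k (d i))] at hf

lemma natCast_le_depth_pi_truncPoly [Finite ι] [Nonempty ι] {q : ℕ} (hqk : q ≤ k)
    (hd : ∀ i, q ≤ d i) : (q : ℕ∞) ≤ depth K (Fin k) (∀ i, TruncPoly K k (d i)) := by
  have hlength : (initialVariables K hqk).length = q := by simp [initialVariables]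
  have hmem : ∀ f ∈ initialVariables K hqk,
      f ∈ Ideal.span (Set.range (X : Fin k → MvPolynomial (Fin k) K)) := fun f hf => by
    obtain ⟨t, -, rfl⟩ := List.mem_map.1 hf
    exact Ideal.subset_span ⟨t, rfl⟩
  rw [← hlength]
  exact le_iSup₂_of_le _ ⟨hmem, isRegular_pi_initialVariables hqk hd⟩ le_rfl

open PowerSeries in
lemma le_hilbertDepth_of_degreeSeries_eq [Fintype ι] [Nonempty ι] {M κ : Type*} [AddCommGroup M]
    [Module K M] {b : Module.Basis κ K M} {deg : κ → ℕ} {a : ι → ℕ} {q : ℕ} (hd : ∀ i, q ≤ d i)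
    (hdk : ∀ i, d i ≤ k) (hdeg : degreeSeries deg = ∑ i, PowerSeries.X ^ a i * mk 1 ^ d i) :
    (q : ℕ∞) ≤ hilbertDepth k (basisPart b fun i => (deg i : ℤ)) := by
  have hqk : q ≤ k := (hd (Classical.arbitrary ι)).trans (hdk _)
  have hfin : Module.Finite (MvPolynomial (Fin k) K) (∀ i, TruncPoly K k (d i)) := by
    have := fun i => TruncPoly.finite (K := K) (hdk i)
    exact Module.Finite.pi
  have hseries : degreeSeries (fun p : Σ i, Fin (d i) →₀ ℕ => a p.1 + p.2.degree) =
      degreeSeries deg := by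
    rw [hdeg, degreeSeries_sigma (deg := fun i (e : Fin (d i) →₀ ℕ) => a i + e.degree)]
    · simp only [degreeSeries_add_left, degreeSeries_degree, Fintype.card_fin]
    · exact fun i j => ((Finsupp.finite_of_degree_le j).subset fun e (he : _ = j) =>
        (Nat.le_add_left _ _).trans he.le).to_subtype
  exact (natCast_le_depth_pi_truncPoly hqk hd).trans <| le_sSup
    ⟨_, inferInstance, inferInstance, inferInstance, inferInstance, _, hfin,
      isGradedModule_basisPart_truncBasis a, hilbertSeries_basisPart_eq _ b hseries, rfl⟩

end TruncatedSums

section MonomialIdeals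

variable {K : Type u} [Field K] {σ : Type*} {E : Set (σ →₀ ℕ)} (hE : IsUpperSet E)

variable (K) in
/-- The basis of the monomials `x^e`, `e ∈ E`, of the monomial ideal they span. -/
noncomputable def monomialBasis : Module.Basis E K (restrictSupportIdeal K E hE) :=
  basisRestrictSupport K E

lemma monomialBasis_repr (f : restrictSupportIdeal K E hE) (e : E) :
    (monomialBasis K hE).repr f e = coeff e.1 f.1 := rfl

lemma coe_monomialBasis (e : E) :
    (monomialBasis K hE e : MvPolynomial σ K) = monomial e.1 1 := by
  classical
  have h : (⟨monomial e.1 1, (monomial_mem_restrictSupport (R := K)).2 (Or.inl e.2)⟩ :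
      restrictSupportIdeal K E hE) = monomialBasis K hE e :=
    (monomialBasis K hE).ext_elem fun e' => by
      rw [(monomialBasis K hE).repr_self_apply, monomialBasis_repr, coeff_monomial]
      simp only [Subtype.ext_iff]
  exact (congrArg Subtype.val h).symm

variable {hE} in
lemma mem_restrictSupport_iff_coeff_eq_zero {f : restrictSupportIdeal K E hE}
    {T : Set (σ →₀ ℕ)} :
    (f : MvPolynomial σ K) ∈ restrictSupport K T ↔ ∀ e : E, e.1 ∉ T → coeff e.1 f.1 = 0 := by
  rw [mem_restrictSupport_iff]
  constructor
  · intro h e he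
    exact notMem_support_iff.1 fun he' => he (h he')
  · intro h e he
    by_contra heT
    exact mem_support_iff.1 he (h ⟨e, f.2 he⟩ heT)

lemma degreePart_restrictSupportIdeal :
    degreePart (restrictSupportIdeal K E hE) =
      basisPart (monomialBasis K hE) fun e => (e.1.degree : ℤ) := by
  ext j f
  rw [mem_basisPart_iff]
  exact mem_restrictSupport_iff_coeff_eq_zero

/-- The exponents of the monomials in the Stanley space `x^e K[Z]`. -/
def monomialCone (e : σ →₀ ℕ) (Z : Finset σ) : Set (σ →₀ ℕ) :=
  {e' | e ≤ e' ∧ (e' - e).support ⊆ Z}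

/-- The exponents in a cone correspond to the exponents in the variables `Z`. -/
noncomputable def monomialConeEquiv (e : σ →₀ ℕ) (Z : Finset σ) :
    (Z →₀ ℕ) ≃ monomialCone e Z where
  toFun g := ⟨e + g.mapDomain Subtype.val, le_self_add, by
    classical
    rw [add_tsub_cancel_left]
    refine Finsupp.mapDomain_support.trans fun s hs => ?_
    obtain ⟨t, -, rfl⟩ := Finset.mem_image.1 hs
    exact t.2⟩
  invFun e' := (e'.1 - e).comapDomain Subtype.val Subtype.val_injective.injOn
  left_inv g := by
    simp only [add_tsub_cancel_left]
    exact Finsupp.comapDomain_mapDomain _ Subtype.val_injective g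
  right_inv e' := Subtype.ext <| by
    change e + ((e'.1 - e).comapDomain _ _).mapDomain _ = e'.1
    rw [Finsupp.mapDomain_comapDomain _ Subtype.val_injective _ fun s hs =>
      ⟨⟨s, e'.2.2 hs⟩, rfl⟩, add_tsub_cancel_of_le e'.2.1]

lemma degreeSeries_monomialCone (e : σ →₀ ℕ) (Z : Finset σ) :
    degreeSeries (fun e' : monomialCone e Z => e'.1.degree) =
      PowerSeries.X ^ e.degree * PowerSeries.mk 1 ^ Z.card := by
  rw [← Fintype.card_coe, ← degreeSeries_degree, ← degreeSeries_add_left]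
  refine (degreeSeries_congr (monomialConeEquiv e Z) fun g => ?_).symm
  rw [monomialConeEquiv, Equiv.coe_fn_mk, map_add, Finsupp.degree_mapDomain]

lemma degreeSeries_eq_sum_of_existsUnique_mem_monomialCone [Finite σ] (hE : IsUpperSet E)
    {ι : Type*} [Fintype ι] {e : ι → E} {Z : ι → Finset σ}
    (h : ∀ e' ∈ E, ∃! i, e' ∈ monomialCone (e i).1 (Z i)) :
    degreeSeries (fun e' : E => e'.1.degree) =
      ∑ i, PowerSeries.X ^ (e i).1.degree * PowerSeries.mk 1 ^ (Z i).card := by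
  have hsub (i : ι) : monomialCone (e i).1 (Z i) ⊆ E := fun _ he => hE he.1 (e i).2
  let φ (x : Σ i, monomialCone (e i).1 (Z i)) : E := ⟨x.2.1, hsub x.1 x.2.2⟩
  have hφ : Function.Bijective φ := by
    refine ⟨?_, fun e' => ?_⟩
    · rintro ⟨i, e', hi⟩ ⟨j, e'', hj⟩ heq
      obtain rfl : e' = e'' := congrArg Subtype.val heq
      obtain rfl := (h e' (hsub i hi)).unique hi hj
      rfl
    · obtain ⟨i, hi⟩ := (h e' e'.2).exists
      exact ⟨⟨i, e'.1, hi⟩, rfl⟩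
  rw [← degreeSeries_congr (deg := fun x => x.2.1.degree) (Equiv.ofBijective φ hφ)
      fun _ => rfl,
    degreeSeries_sigma (deg := fun i (e' : monomialCone (e i).1 (Z i)) => e'.1.degree)]
  · simp only [degreeSeries_monomialCone]
  · exact fun i j => finite_subtype_degree_eq _ j

lemma mem_stanleySpace_iff_of_eq_monomial {I : Ideal (MvPolynomial σ K)} {m : I} {e : σ →₀ ℕ}
    {c : K} (hc : c ≠ 0) (hm : (m : MvPolynomial σ K) = monomial e c) {Z : Finset σ} {f : I} :
    f ∈ stanleySpace (K := K) m Z ↔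
      (f : MvPolynomial σ K) ∈ restrictSupport K (monomialCone e Z) := by
  have hsupp {p : MvPolynomial σ K} :
      p ∈ supported K (Z : Set σ) ↔ ∀ e ∈ p.support, e.support ⊆ Z := by
    simp only [mem_supported, Set.subset_def, Finset.mem_coe, mem_vars_iff_mem_support,
      forall_exists_index, and_imp, Finset.subset_iff]
    exact ⟨fun h e he s => h s e he, fun h s e he hs => h e he hs⟩
  rw [mem_restrictSupport_iff]
  constructor
  · rintro ⟨p, hp, rfl⟩ e' he'
    have hcoeff : coeff e' (p * monomial e c) ≠ 0 := hm ▸ mem_support_iff.1 he'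
    rw [coeff_mul_monomial'] at hcoeff
    split_ifs at hcoeff with hle
    · exact ⟨hle, hsupp.1 hp _ (mem_support_iff.2 (left_ne_zero_of_mul hcoeff))⟩
    · exact absurd rfl hcoeff
  · intro hf
    refine ⟨C c⁻¹ * divMonomial f.1 e, hsupp.2 fun e' he' => ?_, Subtype.ext ?_⟩
    · rw [mem_support_iff, coeff_C_mul, coeff_divMonomial] at he'
      have h := (hf (mem_support_iff.2 (right_ne_zero_of_mul he'))).2
      rwa [add_tsub_cancel_left] at h
    · change C c⁻¹ * divMonomial f.1 e * m.1 = f.1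
      ext e'
      rw [hm, coeff_mul_monomial', coeff_C_mul, coeff_divMonomial]
      split_ifs with hle
      · rw [add_tsub_cancel_of_le hle, mul_right_comm, inv_mul_cancel₀ hc, one_mul]
      · by_contra h
        exact hle (hf (mem_support_iff.2 (Ne.symm h))).1

variable {hE}

namespace StanleyDecomposition

variable (𝒟 : StanleyDecomposition (multidegreePart (restrictSupportIdeal K E hE)))

lemma exists_eq_monomial (i : Fin 𝒟.r) :
    ∃ e : E, ∃ c : K, c ≠ 0 ∧ (𝒟.m i : MvPolynomial σ K) = monomial e.1 c := by
  classical
  obtain ⟨a, ha⟩ := 𝒟.homogeneous i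
  have ha' : ((𝒟.m i : MvPolynomial σ K).support : Set _) ⊆ {e : σ →₀ ℕ | ∀ s, (e s : ℤ) = a s} :=
    ha
  have hne : (𝒟.m i : MvPolynomial σ K) ≠ 0 := fun h =>
    one_ne_zero (𝒟.free i 1 (one_mem _) (by rw [one_smul]; exact Subtype.ext h))
  obtain ⟨e, he⟩ := support_nonempty.2 hne
  refine ⟨⟨e, (𝒟.m i).2 he⟩, _, mem_support_iff.1 he, ?_⟩
  ext e'
  rw [coeff_monomial]
  split_ifs with h
  · rw [← h]
  · by_contra h0
    exact h (Finsupp.ext fun s => by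
      exact_mod_cast (ha' he s).trans (ha' (mem_support_iff.2 h0) s).symm)

/-- The exponent of the monomial generating the `i`-th summand of a Stanley decomposition. -/
noncomputable def exponent (i : Fin 𝒟.r) : E := (𝒟.exists_eq_monomial i).choose

lemma mem_stanleySpace_iff {i : Fin 𝒟.r} {f : restrictSupportIdeal K E hE} :
    f ∈ stanleySpace (K := K) (𝒟.m i) (𝒟.Z i) ↔
      (f : MvPolynomial σ K) ∈ restrictSupport K (monomialCone (𝒟.exponent i).1 (𝒟.Z i)) := by
  obtain ⟨c, hc, hm⟩ := (𝒟.exists_eq_monomial i).choose_spec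
  exact mem_stanleySpace_iff_of_eq_monomial hc hm

lemma monomialBasis_mem_stanleySpace_iff {i : Fin 𝒟.r} {e : E} :
    monomialBasis K hE e ∈ stanleySpace (K := K) (𝒟.m i) (𝒟.Z i) ↔
      e.1 ∈ monomialCone (𝒟.exponent i).1 (𝒟.Z i) := by
  rw [mem_stanleySpace_iff, coe_monomialBasis, monomial_mem_restrictSupport,
    or_iff_left one_ne_zero]

lemma existsUnique_mem_monomialCone (e : E) :
    ∃! i, e.1 ∈ monomialCone (𝒟.exponent i).1 (𝒟.Z i) := by
  refine existsUnique_of_exists_of_unique ?_ fun i j hi hj => ?_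
  · by_contra! hcon
    have hker : ⨆ i, stanleySpace (K := K) (𝒟.m i) (𝒟.Z i) ≤
        LinearMap.ker ((monomialBasis K hE).coord e) := iSup_le fun i f hf =>
      notMem_support_iff.1 fun he => hcon i (𝒟.mem_stanleySpace_iff.1 hf he)
    rw [𝒟.isInternal.submodule_iSup_eq_top] at hker
    have h : (monomialBasis K hE).coord e (monomialBasis K hE e) = 0 := hker Submodule.mem_top
    simp at h
  · by_contra hij
    exact (monomialBasis K hE).ne_zero e <|
      Submodule.disjoint_def.1 (𝒟.isInternal.submodule_iSupIndep.pairwiseDisjoint hij) _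
        (𝒟.monomialBasis_mem_stanleySpace_iff.2 hi) (𝒟.monomialBasis_mem_stanleySpace_iff.2 hj)

end StanleyDecomposition

theorem sdepth_le_hdepth {k : ℕ} {E : Set (Fin k →₀ ℕ)} (hE : IsUpperSet E) (hne : E.Nonempty) :
    sdepth (restrictSupportIdeal K E hE) ≤ hdepth (restrictSupportIdeal K E hE) := by
  refine iSup_le fun 𝒟 => ?_
  obtain ⟨e, he⟩ := hne
  have : Nonempty (Fin 𝒟.r) := ⟨(𝒟.existsUnique_mem_monomialCone ⟨e, he⟩).choose⟩
  have htop : 𝒟.sdepth ≠ ⊤ :=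
    ne_top_of_le_ne_top (ENat.natCast_ne_top _) (iInf_le _ (Classical.arbitrary (Fin 𝒟.r)))
  obtain ⟨q, hq⟩ := ENat.ne_top_iff_exists.1 htop
  rw [← hq, hdepth, degreePart_restrictSupportIdeal]
  exact le_hilbertDepth_of_degreeSeries_eq
    (fun i => Nat.cast_le.1 (hq.trans_le (iInf_le _ i)))
    (fun i => (Finset.card_le_univ _).trans (Fintype.card_fin k).le)
    (degreeSeries_eq_sum_of_existsUnique_mem_monomialCone hE fun e he =>
      𝒟.existsUnique_mem_monomialCone ⟨e, he⟩)

theorem le_sdepth_of_existsUnique_mem_monomialCone {ι : Type*} [Finite ι] {e : ι → E}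
    {Z : ι → Finset σ} (huniq : ∀ e' ∈ E, ∃! i, e' ∈ monomialCone (e i).1 (Z i)) {d : ℕ}
    (hd : ∀ i, d ≤ (Z i).card) : (d : ℕ∞) ≤ sdepth (restrictSupportIdeal K E hE) := by
  classical
  obtain ⟨r, ⟨φ⟩⟩ := Finite.exists_equiv_fin ι
  choose w hw hw' using fun e' : E => huniq e'.1 e'.2
  have hspace (i : Fin r) :
      stanleySpace (K := K) (monomialBasis K hE (e (φ.symm i))) (Z (φ.symm i)) =
        basisPart (monomialBasis K hE) (fun e' => φ (w e')) i := by
    ext f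
    rw [mem_stanleySpace_iff_of_eq_monomial one_ne_zero (coe_monomialBasis hE _),
      mem_restrictSupport_iff_coeff_eq_zero, mem_basisPart_iff]
    refine forall_congr' fun e' => imp_congr_left (not_congr ⟨fun h => ?_, ?_⟩)
    · rw [← hw' e' _ h, Equiv.apply_symm_apply]
    · rintro rfl
      rw [Equiv.symm_apply_apply]
      exact hw e'
  let 𝒟 : StanleyDecomposition (multidegreePart (restrictSupportIdeal K E hE)) :=
    { r := r
      m := fun i => monomialBasis K hE (e (φ.symm i))
      Z := fun i => Z (φ.symm i)
      homogeneous := fun i => ⟨fun s => (e (φ.symm i)).1 s, by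
        rw [multidegreePart, Submodule.mem_comap]
        change (monomialBasis K hE (e (φ.symm i)) : MvPolynomial σ K) ∈ _
        rw [coe_monomialBasis]
        exact (monomial_mem_restrictSupport (R := K)).2 (Or.inl fun _ => rfl)⟩
      free := fun i p _ h => (smul_eq_zero.1 h).resolve_right ((monomialBasis K hE).ne_zero _)
      isInternal := by
        simp only [hspace]
        exact isInternal_basisPart _ _ }
  have h : (d : ℕ∞) ≤ 𝒟.sdepth := le_iInf fun i => Nat.cast_le.2 (hd (φ.symm i))
  exact h.trans (le_iSup (fun 𝒟 : StanleyDecomposition _ => 𝒟.sdepth) 𝒟)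

/-- The exponent of the product of the variables in `A`. -/
noncomputable def squarefreeExponent (A : Finset σ) : σ →₀ ℕ :=
  Finsupp.indicator A fun _ _ => 1

lemma squarefreeExponent_le_iff {A : Finset σ} {e : σ →₀ ℕ} :
    squarefreeExponent A ≤ e ↔ A ⊆ e.support := by
  classical
  simp only [Finsupp.le_def, squarefreeExponent, Finsupp.indicator_apply, Finset.subset_iff,
    Finsupp.mem_support_iff]
  refine forall_congr' fun s => ?_
  split_ifs with hs <;> simp [hs, Nat.one_le_iff_ne_zero]

lemma support_squarefreeExponent (A : Finset σ) : (squarefreeExponent A).support = A := by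
  classical
  ext s
  simp [squarefreeExponent, Finsupp.indicator_apply]

lemma mem_monomialCone_squarefreeExponent_iff {A B : Finset σ} (hAB : A ⊆ B) {e : σ →₀ ℕ} :
    e ∈ monomialCone (squarefreeExponent A) B ↔ A ⊆ e.support ∧ e.support ⊆ B := by
  refine and_congr squarefreeExponent_le_iff ⟨fun h s hs => ?_, fun h => ?_⟩
  · by_contra hsB
    have hsA : squarefreeExponent A s = 0 := by
      rw [← Finsupp.notMem_support_iff, support_squarefreeExponent]
      exact fun hsA => hsB (hAB hsA)
    refine hsB (h (Finsupp.mem_support_iff.2 ?_))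
    rw [Finsupp.tsub_apply, hsA, tsub_zero]
    exact Finsupp.mem_support_iff.1 hs
  · exact (Finsupp.support_mono tsub_le_self).trans h

lemma IsIntervalPartition.existsUnique_mem_monomialCone {S : Set (Finset σ)} {ι : Type*}
    {A B : ι → Finset σ} (h : IsIntervalPartition S A B) {e : σ →₀ ℕ} (he : e.support ∈ S) :
    ∃! i, e ∈ monomialCone (squarefreeExponent (A i)) (B i) := by
  simp only [mem_monomialCone_squarefreeExponent_iff (h.le _)]
  exact h.existsUnique _ he

lemma IsIntervalPartition.support_squarefreeExponent_mem {S : Set (Finset σ)} {ι : Type*}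
    {A B : ι → Finset σ} (h : IsIntervalPartition S A B) (i : ι) :
    (squarefreeExponent (A i)).support ∈ S := by
  rw [support_squarefreeExponent]
  exact h.Icc_subset i ⟨le_rfl, h.le i⟩

theorem le_sdepth_of_isIntervalPartition {S : Set (Finset σ)}
    (hS : IsUpperSet {e : σ →₀ ℕ | e.support ∈ S}) {ι : Type*} [Finite ι] {A B : ι → Finset σ}
    (h : IsIntervalPartition S A B) {d : ℕ} (hd : ∀ i, d ≤ (B i).card) :
    (d : ℕ∞) ≤ sdepth (restrictSupportIdeal K _ hS) :=
  le_sdepth_of_existsUnique_mem_monomialCone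
    (e := fun i => ⟨squarefreeExponent (A i), h.support_squarefreeExponent_mem i⟩)
    (fun _ => h.existsUnique_mem_monomialCone) hd

end MonomialIdeals

section HilbertCone

open PowerSeries (mk)

/-- The sums of the power series `X ^ a / (1 - X) ^ d` with `q ≤ d ≤ k`. -/
noncomputable def hilbertCone (q k : ℕ) : AddSubmonoid (PowerSeries ℤ) :=
  AddSubmonoid.closure {f | ∃ a d, q ≤ d ∧ d ≤ k ∧ PowerSeries.X ^ a * mk 1 ^ d = f}

lemma X_pow_mul_mk_one_pow_mem_hilbertCone {q k d : ℕ} (a : ℕ) (hq : q ≤ d) (hk : d ≤ k) :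
    PowerSeries.X ^ a * mk 1 ^ d ∈ hilbertCone q k :=
  AddSubmonoid.subset_closure ⟨a, d, hq, hk, rfl⟩

lemma X_pow_mul_mk_one_pow_mul_mem_hilbertCone {q k q' k' e : ℕ} (a : ℕ) (hq : q' ≤ q + e)
    (hk : k + e ≤ k') {f : PowerSeries ℤ} (hf : f ∈ hilbertCone q k) :
    PowerSeries.X ^ a * mk 1 ^ e * f ∈ hilbertCone q' k' := by
  induction hf using AddSubmonoid.closure_induction with
  | mem f hf =>
    obtain ⟨b, d, hd, hdk, rfl⟩ := hf
    rw [mul_mul_mul_comm, ← pow_add, ← pow_add]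
    exact X_pow_mul_mk_one_pow_mem_hilbertCone _ (by lia) (by lia)
  | zero => rw [mul_zero]; exact zero_mem _
  | add f g _ _ hf hg => rw [mul_add]; exact add_mem hf hg

theorem le_hilbertDepth_of_degreeSeries_mem_hilbertCone {K : Type u} [Field K] {M κ : Type*}
    [AddCommGroup M] [Module K M] {b : Module.Basis κ K M} {deg : κ → ℕ} {q k : ℕ}
    (hne : degreeSeries deg ≠ 0) (hmem : degreeSeries deg ∈ hilbertCone q k) :
    (q : ℕ∞) ≤ hilbertDepth k (basisPart b fun i => (deg i : ℤ)) := by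
  obtain ⟨l, hl, hsum⟩ := AddSubmonoid.exists_list_of_mem_closure hmem
  choose a d hq hk hget using fun i : Fin l.length => hl _ (List.get_mem l i)
  have hdeg : degreeSeries deg = ∑ i, PowerSeries.X ^ a i * mk 1 ^ d i := by
    simp only [hget, ← hsum, List.get_eq_getElem, Fin.sum_univ_getElem]
  have : Nonempty (Fin l.length) := by
    by_contra hempty
    rw [not_nonempty_iff] at hempty
    exact hne (hdeg.trans (Finset.sum_of_isEmpty _))
  exact le_hilbertDepth_of_degreeSeries_eq hq hk hdeg

-- The cones over a partition of the nonempty subsets into intervals partition the nonconstant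
-- monomials, whose generating function is `1 / (1 - X) ^ n - 1`.
lemma mk_one_pow_sub_one_mem_hilbertCone (n : ℕ) :
    mk 1 ^ n - 1 ∈ hilbertCone ((n + 1) / 2) n := by
  obtain ⟨ι, _, A, B, hAB, hB⟩ := exists_isIntervalPartition_nonempty n
  have := Fintype.ofFinite ι
  have hE : IsUpperSet {e : Fin n →₀ ℕ | e ≠ 0} := fun e e' hle he he' =>
    he (le_antisymm (hle.trans he'.le) zero_le)
  have hA (i : ι) : squarefreeExponent (A i) ≠ 0 :=
    Finsupp.support_nonempty_iff.1 (hAB.support_squarefreeExponent_mem i)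
  have hsum := degreeSeries_eq_sum_of_existsUnique_mem_monomialCone hE
    (e := fun i => ⟨squarefreeExponent (A i), hA i⟩) (Z := B) fun e he =>
      hAB.existsUnique_mem_monomialCone (Finsupp.support_nonempty_iff.2 he)
  have hseries := degreeSeries_degree_ne_zero (Fin n)
  rw [Fintype.card_fin] at hseries
  rw [← hseries]
  refine hsum.symm ▸ sum_mem fun i _ => ?_
  exact X_pow_mul_mk_one_pow_mem_hilbertCone _ (hB i)
    ((Finset.card_le_univ _).trans (Fintype.card_fin n).le)

lemma X_mul_mk_one : (PowerSeries.X : PowerSeries ℤ) * mk 1 = mk 1 - 1 := by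
  linear_combination -PowerSeries.mk_one_mul_one_sub_eq_one ℤ

lemma sum_X_mul_mk_one_pow (n : ℕ) :
    ∑ l ∈ Finset.range n, PowerSeries.X * mk 1 ^ (l + 1) = (mk 1 ^ n - 1 : PowerSeries ℤ) := by
  rw [← pow_zero (mk 1 : PowerSeries ℤ), ← Finset.sum_range_sub]
  refine Finset.sum_congr rfl fun l _ => ?_
  linear_combination mk 1 ^ l * X_mul_mk_one

lemma mk_one_pow_sub_one_mul_eq_sum {n m : ℕ} (hmn : m ≤ n) :
    (mk 1 ^ n - 1) * (mk 1 ^ m - 1) =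
      ∑ l ∈ Finset.range m, (PowerSeries.X ^ 1 * mk 1 ^ (m - l) *
        (mk 1 ^ (n - m + 2 * l + 1) - 1) : PowerSeries ℤ) := by
  have hterm (l : ℕ) (hl : l ∈ Finset.range m) :
      (PowerSeries.X ^ 1 * mk 1 ^ (m - l) * (mk 1 ^ (n - m + 2 * l + 1) - 1) : PowerSeries ℤ) =
        mk 1 ^ n * (PowerSeries.X * mk 1 ^ (l + 1)) -
          PowerSeries.X * mk 1 ^ ((m - 1 - l) + 1) := by
    have hl := Finset.mem_range.1 hl
    have h : m - l + (n - m + 2 * l + 1) = n + (l + 1) := by lia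
    have h' : m - 1 - l + 1 = m - l := by lia
    rw [h', mul_sub, mul_assoc, ← pow_add, h, pow_add]
    ring
  rw [Finset.sum_congr rfl hterm, Finset.sum_sub_distrib, ← Finset.mul_sum,
    Finset.sum_range_reflect (fun l => (PowerSeries.X * mk 1 ^ (l + 1) : PowerSeries ℤ)) m,
    sum_X_mul_mk_one_pow]
  ring

lemma mk_one_pow_sub_one_mul_mem_hilbertCone (n m : ℕ) :
    (mk 1 ^ n - 1) * (mk 1 ^ m - 1) ∈ hilbertCone ((n + m + 2) / 2) (n + m) := by
  wlog hmn : m ≤ n generalizing n m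
  · rw [mul_comm, add_comm n]
    exact this m n (le_of_not_ge hmn)
  rw [mk_one_pow_sub_one_mul_eq_sum hmn]
  refine sum_mem fun l hl => ?_
  have hl := Finset.mem_range.1 hl
  exact X_pow_mul_mk_one_pow_mul_mem_hilbertCone _ (by lia) (by lia)
    (mk_one_pow_sub_one_mem_hilbertCone _)

end HilbertCone

section BipartiteIdeal

open PowerSeries (mk)

/-- A set of variables, split into those among the first `n` and those among the last `m`. -/
def splitFinset (n m : ℕ) : Finset (Fin (n + m)) ≃o Finset (Fin n) × Finset (Fin m) :=
  OrderIso.trans ⟨finSumFinEquiv.symm.finsetCongr, Finset.map_subset_map⟩ Finset.sumEquiv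

lemma splitFinset_apply {n m : ℕ} (C : Finset (Fin (n + m))) :
    splitFinset n m C = Finset.sumEquiv (C.map finSumFinEquiv.symm.toEmbedding) := rfl

/-- Exponents in `n + m` variables, split into those of the first `n` and of the last `m`. -/
noncomputable def splitExponent (n m : ℕ) :
    (Fin (n + m) →₀ ℕ) ≃ (Fin n →₀ ℕ) × (Fin m →₀ ℕ) :=
  (Finsupp.domCongr (M := ℕ) finSumFinEquiv.symm).toEquiv.trans Finsupp.sumFinsuppEquivProdFinsupp

variable {n m : ℕ}

lemma splitExponent_fst_apply (e : Fin (n + m) →₀ ℕ) (i : Fin n) :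
    (splitExponent n m e).1 i = e (Fin.castAdd m i) := by
  simp [splitExponent]

lemma splitExponent_snd_apply (e : Fin (n + m) →₀ ℕ) (j : Fin m) :
    (splitExponent n m e).2 j = e (Fin.natAdd n j) := by
  simp [splitExponent]

lemma degree_splitExponent (e : Fin (n + m) →₀ ℕ) :
    (splitExponent n m e).1.degree + (splitExponent n m e).2.degree = e.degree := by
  simp only [Finsupp.degree_eq_sum, Fin.sum_univ_add, splitExponent_fst_apply,
    splitExponent_snd_apply]

lemma splitFinset_support (e : Fin (n + m) →₀ ℕ) :
    splitFinset n m e.support =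
      ((splitExponent n m e).1.support, (splitExponent n m e).2.support) := by
  ext s <;> simp [splitFinset_apply, Finset.sumEquiv, splitExponent_fst_apply,
    splitExponent_snd_apply]

lemma card_splitFinset_symm (p : Finset (Fin n) × Finset (Fin m)) :
    ((splitFinset n m).symm p).card = p.1.card + p.2.card := by
  change (Finset.map _ (p.1.disjSum p.2)).card = _
  rw [Finset.card_map, Finset.card_disjSum]

/-- The supports of the monomials in `(x_1, …, x_n) ∩ (x_{n+1}, …, x_{n+m})`. -/
def bipartiteSupports (n m : ℕ) : Set (Finset (Fin (n + m))) :=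
  splitFinset n m ⁻¹' {C | C.Nonempty} ×ˢ {C | C.Nonempty}

lemma support_mem_bipartiteSupports_iff {e : Fin (n + m) →₀ ℕ} :
    e.support ∈ bipartiteSupports n m ↔
      (splitExponent n m e).1 ≠ 0 ∧ (splitExponent n m e).2 ≠ 0 := by
  rw [bipartiteSupports, Set.mem_preimage, splitFinset_support, Set.mem_prod]
  exact and_congr Finsupp.support_nonempty_iff Finsupp.support_nonempty_iff

lemma isUpperSet_support_mem_bipartiteSupports (n m : ℕ) :
    IsUpperSet {e : Fin (n + m) →₀ ℕ | e.support ∈ bipartiteSupports n m} := by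
  intro e e' hle he
  have h := (splitFinset n m).monotone (Finsupp.support_mono hle)
  exact ⟨he.1.mono h.1, he.2.mono h.2⟩

variable {K : Type u} [Field K]

lemma bipartiteIdeal_eq_restrictSupportIdeal :
    bipartiteIdeal K n m =
      restrictSupportIdeal K _ (isUpperSet_support_mem_bipartiteSupports n m) := by
  ext f
  have hl : (Set.range fun i : Fin n => (X (Fin.castAdd m i) : MvPolynomial (Fin (n + m)) K)) =
      X '' Set.range (Fin.castAdd m) := by rw [← Set.range_comp]; rfl
  have hr : (Set.range fun j : Fin m => (X (Fin.natAdd n j) : MvPolynomial (Fin (n + m)) K)) =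
      X '' Set.range (Fin.natAdd n) := by rw [← Set.range_comp]; rfl
  rw [bipartiteIdeal, Ideal.mem_inf, hl, hr, mem_ideal_span_X_image, mem_ideal_span_X_image,
    ← forall₂_and]
  refine forall₂_congr fun e _ => ?_
  change _ ↔ e.support ∈ bipartiteSupports n m
  rw [support_mem_bipartiteSupports_iff]
  simp only [Set.exists_range_iff, ne_eq, DFunLike.ext_iff, splitExponent_fst_apply,
    splitExponent_snd_apply, not_forall, Finsupp.coe_zero, Pi.zero_apply]

lemma degreeSeries_bipartiteSupports (n m : ℕ) :
    degreeSeries (fun e : {e : Fin (n + m) →₀ ℕ | e.support ∈ bipartiteSupports n m} =>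
      e.1.degree) = (mk 1 ^ n - 1) * (mk 1 ^ m - 1) := by
  have hprod := degreeSeries_prod (finite_subtype_degree_eq fun e : Fin n →₀ ℕ => e ≠ 0)
    (finite_subtype_degree_eq fun e : Fin m →₀ ℕ => e ≠ 0)
  rw [degreeSeries_degree_ne_zero, degreeSeries_degree_ne_zero, Fintype.card_fin,
    Fintype.card_fin] at hprod
  rw [← hprod]
  let φ : {e : Fin (n + m) →₀ ℕ | e.support ∈ bipartiteSupports n m} ≃
      {e : Fin n →₀ ℕ // e ≠ 0} × {e : Fin m →₀ ℕ // e ≠ 0} :=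
    ((splitExponent n m).subtypeEquiv (q := fun p => p.1 ≠ 0 ∧ p.2 ≠ 0)
      fun _ => support_mem_bipartiteSupports_iff).trans
        (Equiv.subtypeProdEquivProd (p := fun e => e ≠ 0) (q := fun e => e ≠ 0))
  exact degreeSeries_congr φ fun e => degree_splitExponent e.1

lemma hilbertSeries_bipartiteIdeal_natCast (j : ℕ) :
    (hilbertSeries (degreePart (bipartiteIdeal K n m)) j : ℤ) =
      PowerSeries.coeff j ((mk 1 ^ n - 1) * (mk 1 ^ m - 1)) := by
  rw [bipartiteIdeal_eq_restrictSupportIdeal, degreePart_restrictSupportIdeal,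
    coe_hilbertSeries_basisPart, degreeSeries_bipartiteSupports]

lemma coeff_zero_mk_one_pow_sub_one (n : ℕ) :
    PowerSeries.coeff 0 (mk 1 ^ n - 1 : PowerSeries ℤ) = 0 := by
  simp

lemma coeff_succ_mk_one_pow_succ_sub_one (n j : ℕ) :
    PowerSeries.coeff (j + 1) (mk 1 ^ (n + 1) - 1 : PowerSeries ℤ) =
      PowerSeries.coeff (j + 1) (mk 1 ^ n - 1 : PowerSeries ℤ) +
        PowerSeries.coeff j (mk 1 ^ (n + 1) : PowerSeries ℤ) := by
  rw [← PowerSeries.coeff_succ_X_mul j, ← map_add]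
  congr 1
  linear_combination (-mk 1 ^ n) * X_mul_mk_one

lemma coeff_one_mk_one_pow_sub_one (n : ℕ) :
    PowerSeries.coeff 1 (mk 1 ^ n - 1 : PowerSeries ℤ) = n := by
  induction n with
  | zero => simp
  | succ n ih =>
    rw [coeff_succ_mk_one_pow_succ_sub_one n 0, zero_add, ih]
    simp

lemma two_mul_coeff_two_mk_one_pow_sub_one (n : ℕ) :
    2 * PowerSeries.coeff 2 (mk 1 ^ n - 1 : PowerSeries ℤ) = n * (n + 1) := by
  induction n with
  | zero => simp
  | succ n ih =>
    have h := coeff_one_mk_one_pow_sub_one (n + 1)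
    rw [map_sub, PowerSeries.coeff_one, if_neg one_ne_zero, sub_zero] at h
    rw [coeff_succ_mk_one_pow_succ_sub_one n 1, mul_add, ih, h]
    push_cast
    ring

lemma hilbertSeries_bipartiteIdeal_of_lt_two {j : ℤ} (hj : j < 2) :
    hilbertSeries (degreePart (bipartiteIdeal K n m)) j = 0 := by
  obtain hj0 | hj0 := lt_or_ge j 0
  · rw [bipartiteIdeal_eq_restrictSupportIdeal, degreePart_restrictSupportIdeal,
      hilbertSeries_basisPart_of_neg _ _ hj0]
  · obtain ⟨i, rfl⟩ := Int.eq_ofNat_of_zero_le hj0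
    rw [← Nat.cast_inj (R := ℤ), hilbertSeries_bipartiteIdeal_natCast, Nat.cast_zero]
    obtain rfl | rfl : i = 0 ∨ i = 1 := by lia
    all_goals simp only [PowerSeries.coeff_mul, Finset.Nat.sum_antidiagonal_eq_sum_range_succ_mk,
      Finset.sum_range_succ, Finset.sum_range_zero, Nat.reduceSub, coeff_zero_mk_one_pow_sub_one,
      zero_mul, mul_zero, add_zero]

lemma hilbertSeries_bipartiteIdeal_two :
    hilbertSeries (degreePart (bipartiteIdeal K n m)) 2 = n * m := by
  have h := hilbertSeries_bipartiteIdeal_natCast (K := K) (n := n) (m := m) 2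
  simp only [PowerSeries.coeff_mul, Finset.Nat.sum_antidiagonal_eq_sum_range_succ_mk,
    Finset.sum_range_succ, Finset.sum_range_zero, Nat.reduceSub, coeff_zero_mk_one_pow_sub_one,
    coeff_one_mk_one_pow_sub_one, zero_mul, mul_zero, zero_add, add_zero] at h
  exact_mod_cast h

lemma two_mul_hilbertSeries_bipartiteIdeal_three :
    2 * hilbertSeries (degreePart (bipartiteIdeal K n m)) 3 = n * m * (n + m + 2) := by
  have h := hilbertSeries_bipartiteIdeal_natCast (K := K) (n := n) (m := m) 3
  simp only [PowerSeries.coeff_mul, Finset.Nat.sum_antidiagonal_eq_sum_range_succ_mk,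
    Finset.sum_range_succ, Finset.sum_range_zero, Nat.reduceSub, coeff_zero_mk_one_pow_sub_one,
    coeff_one_mk_one_pow_sub_one, zero_mul, mul_zero, zero_add, add_zero] at h
  have hn := two_mul_coeff_two_mk_one_pow_sub_one n
  have hm := two_mul_coeff_two_mk_one_pow_sub_one m
  have h' : (2 * hilbertSeries (degreePart (bipartiteIdeal K n m)) 3 : ℤ) =
      n * m * (n + m + 2) := by
    linear_combination 2 * h + n * hm + m * hn
  exact_mod_cast h'

theorem hdepth_bipartiteIdeal_le (hn : 1 ≤ n) (hm : 1 ≤ m) :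
    hdepth (bipartiteIdeal K n m) ≤ (((n + m + 2) / 2 : ℕ) : ℕ∞) := by
  refine sSup_le ?_
  rintro _ ⟨N, _, _, _, _, 𝒩, hfin, hgr, hser, rfl⟩
  refine iSup₂_le fun rs hrs => Nat.cast_le.2 ?_
  have hbot (j : ℤ) (hj : j < 2) : 𝒩 j = ⊥ := by
    have := hgr.finite_component j
    rw [← Submodule.finrank_eq_zero (R := K)]
    exact (congrFun hser j).trans (hilbertSeries_bipartiteIdeal_of_lt_two hj)
  have hle : rs.length * hilbertSeries 𝒩 2 ≤ hilbertSeries 𝒩 3 :=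
    hgr.length_mul_hilbertSeries_le hbot hrs.1 hrs.2.toIsWeaklyRegular
  rw [hser, hilbertSeries_bipartiteIdeal_two] at hle
  have h3 := two_mul_hilbertSeries_bipartiteIdeal_three (K := K) (n := n) (m := m)
  have hmul : n * m * (2 * rs.length) ≤ n * m * (n + m + 2) := by
    rw [← h3]
    linarith
  have := Nat.le_of_mul_le_mul_left hmul (Nat.mul_pos hn hm)
  lia

theorem le_hdepth_bipartiteIdeal (hn : 1 ≤ n) (hm : 1 ≤ m) :
    (((n + m + 2) / 2 : ℕ) : ℕ∞) ≤ hdepth (bipartiteIdeal K n m) := by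
  have hmem := mk_one_pow_sub_one_mul_mem_hilbertCone n m
  have hne : (mk 1 ^ n - 1 : PowerSeries ℤ) * (mk 1 ^ m - 1) ≠ 0 := by
    have h (k : ℕ) (hk : 1 ≤ k) : (mk 1 ^ k - 1 : PowerSeries ℤ) ≠ 0 := fun h0 => by
      have h1 := coeff_one_mk_one_pow_sub_one k
      rw [h0, map_zero] at h1
      lia
    exact mul_ne_zero (h n hn) (h m hm)
  rw [← degreeSeries_bipartiteSupports] at hmem hne
  rw [hdepth, bipartiteIdeal_eq_restrictSupportIdeal, degreePart_restrictSupportIdeal]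
  exact le_hilbertDepth_of_degreeSeries_mem_hilbertCone hne hmem

theorem hdepth_bipartiteIdeal (hn : 1 ≤ n) (hm : 1 ≤ m) :
    hdepth (bipartiteIdeal K n m) = (((n + m + 2) / 2 : ℕ) : ℕ∞) :=
  le_antisymm (hdepth_bipartiteIdeal_le hn hm) (le_hdepth_bipartiteIdeal hn hm)

theorem le_sdepth_bipartiteIdeal :
    (((n + 1) / 2 + (m + 1) / 2 : ℕ) : ℕ∞) ≤ sdepth (bipartiteIdeal K n m) := by
  obtain ⟨ι, _, A, B, hAB, hB⟩ := exists_isIntervalPartition_nonempty n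
  obtain ⟨κ, _, A', B', hAB', hB'⟩ := exists_isIntervalPartition_nonempty m
  rw [bipartiteIdeal_eq_restrictSupportIdeal]
  refine le_sdepth_of_isIntervalPartition _ ((hAB.prod hAB').preimage (splitFinset n m)) fun i => ?_
  rw [Function.comp_apply, card_splitFinset_symm]
  exact Nat.add_le_add (hB i.1) (hB' i.2)

theorem sdepth_bipartiteIdeal_le_hdepth (hn : 1 ≤ n) (hm : 1 ≤ m) :
    sdepth (bipartiteIdeal K n m) ≤ hdepth (bipartiteIdeal K n m) := by
  rw [bipartiteIdeal_eq_restrictSupportIdeal]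
  refine sdepth_le_hdepth _ ⟨(splitExponent n m).symm
    (Finsupp.single ⟨0, hn⟩ 1, Finsupp.single ⟨0, hm⟩ 1), ?_⟩
  rw [Set.mem_ofPred_eq, support_mem_bipartiteSupports_iff, Equiv.apply_symm_apply]
  simp only [ne_eq, Finsupp.single_eq_zero, one_ne_zero, not_false_eq_true, and_self]

end BipartiteIdeal

lemma ceil_natCast_div_two (n : ℕ) : ⌈(n : ℚ) / 2⌉₊ = (n + 1) / 2 := by
  refine le_antisymm (Nat.ceil_le.2 ?_) ?_
  · rw [div_le_iff₀ two_pos]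
    exact_mod_cast (by lia : n ≤ (n + 1) / 2 * 2)
  · have h := Nat.le_ceil ((n : ℚ) / 2)
    rw [div_le_iff₀ two_pos] at h
    have h' : n ≤ ⌈(n : ℚ) / 2⌉₊ * 2 := by exact_mod_cast h
    lia

lemma floor_natCast_add_add_two_div_two (n m : ℕ) :
    ⌊((n : ℚ) + m + 2) / 2⌋₊ = (n + m + 2) / 2 := by
  have h : ((n : ℚ) + m + 2) / 2 = ((n + m + 2 : ℕ) : ℚ) / (2 : ℕ) := by push_cast; rfl
  rw [h, Nat.floor_div_eq_div]

end StanleyHilbert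

theorem theorem2p6_general {K : Type u} [Field K] (n m : ℕ) (hn : 1 ≤ n) (hm : 1 ≤ m) :
    (¬ (Even n ∧ Even m) →
      StanleyHilbert.sdepth (StanleyHilbert.bipartiteIdeal K n m) =
          StanleyHilbert.hdepth (StanleyHilbert.bipartiteIdeal K n m) ∧
        StanleyHilbert.hdepth (StanleyHilbert.bipartiteIdeal K n m) =
          ((⌈(n : ℚ) / 2⌉₊ + ⌈(m : ℚ) / 2⌉₊ : ℕ) : ℕ∞)) ∧
    (∀ t s : ℕ, n = 2 * t → m = 2 * s →
      ((t + s : ℕ) : ℕ∞) ≤ StanleyHilbert.sdepth (StanleyHilbert.bipartiteIdeal K n m) ∧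
        StanleyHilbert.sdepth (StanleyHilbert.bipartiteIdeal K n m) ≤
          StanleyHilbert.hdepth (StanleyHilbert.bipartiteIdeal K n m) ∧
        StanleyHilbert.hdepth (StanleyHilbert.bipartiteIdeal K n m) = ((t + s + 1 : ℕ) : ℕ∞)) ∧
    StanleyHilbert.hdepth (StanleyHilbert.bipartiteIdeal K n m) =
      ((⌊((n : ℚ) + m + 2) / 2⌋₊ : ℕ) : ℕ∞) := by
  have hh := StanleyHilbert.hdepth_bipartiteIdeal (K := K) hn hm
  have hle := StanleyHilbert.sdepth_bipartiteIdeal_le_hdepth (K := K) hn hm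
  have hge := StanleyHilbert.le_sdepth_bipartiteIdeal (K := K) (n := n) (m := m)
  rw [hh] at hle
  rw [hh, StanleyHilbert.ceil_natCast_div_two, StanleyHilbert.ceil_natCast_div_two,
    StanleyHilbert.floor_natCast_add_add_two_div_two]
  refine ⟨fun hpar => ?_, fun t s ht hs => ⟨?_, hle, ?_⟩, rfl⟩
  · have h : (n + 1) / 2 + (m + 1) / 2 = (n + m + 2) / 2 := by
      rw [Nat.even_iff, Nat.even_iff] at hpar
      lia
    rw [h] at hge ⊢
    exact ⟨le_antisymm hle hge, rfl⟩
  · exact le_trans (Nat.cast_le.2 (by lia)) hge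
  · exact congrArg Nat.cast (by lia)

theorem theorem2p6 {K : Type u} [Field K] (n m : ℕ) (hm : 1 ≤ m) (hmn : m ≤ n) :
    (¬ (Even n ∧ Even m) →
      StanleyHilbert.sdepth (StanleyHilbert.bipartiteIdeal K n m) =
          StanleyHilbert.hdepth (StanleyHilbert.bipartiteIdeal K n m) ∧
        StanleyHilbert.hdepth (StanleyHilbert.bipartiteIdeal K n m) =
          ((⌈(n : ℚ) / 2⌉₊ + ⌈(m : ℚ) / 2⌉₊ : ℕ) : ℕ∞)) ∧
    (∀ t s : ℕ, n = 2 * t → m = 2 * s →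
      ((t + s : ℕ) : ℕ∞) ≤ StanleyHilbert.sdepth (StanleyHilbert.bipartiteIdeal K n m) ∧
        StanleyHilbert.sdepth (StanleyHilbert.bipartiteIdeal K n m) ≤
          StanleyHilbert.hdepth (StanleyHilbert.bipartiteIdeal K n m) ∧
        StanleyHilbert.hdepth (StanleyHilbert.bipartiteIdeal K n m) = ((t + s + 1 : ℕ) : ℕ∞)) ∧
    StanleyHilbert.hdepth (StanleyHilbert.bipartiteIdeal K n m) =
      ((⌊((n : ℚ) + m + 2) / 2⌋₊ : ℕ) : ℕ∞) :=
  theorem2p6_general n m (hm.trans hmn) hm
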